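/- **Setting.** Let $q\ge 1$, $a_i\in\mathbb R$, $\sigma_i\ge 0$ $(1\le i\le q)$, and let $(\eta_n)_{n\ge1}$, $\eta_n=(\eta_{1n},\dots,\eta_{qn})'$, and $(\xi_n)_{n\ge1}$ be independent sequences of random vectors and real random variables on a probability space, each sequence i.i.d., with $\mathbf E\xi_1=\mathbf E\eta_{i1}=0$ and $\mathbf E\xi_1^2=\mathbf E\eta_{i1}^2=1$. Put $\alpha_{in}=a_i+\sigma_i\eta_{in}$, $\zeta_n=(\xi_n,0,\dots,0)'\in\mathbb R^q$, and let $A_n$ be the $q\times q$ matrix with first row $(\alpha_{1n},\dots,\alpha_{qn})$, whose remaining rows are $(I_{q-1}\;\;0)$. Let $|\cdot|$ be the Euclidean norm on $\mathbb R^q$, $|A|^2=\operatorname{tr}AA'$, $S=\{z\in\mathbb R^q:|z|=1\}$ and $\bar z=z/|z|$ for $z\neq0$. Set $$Y=\zeta_1+\sum_{k\ge2}A_1\cdots A_{k-1}\zeta_k,\qquad Y_1=\zeta_2+\sum_{k\ge3}A_2\cdots A_{k-1}\zeta_k .$$ **Assumptions.** * (D0) All eigenvalues of $\mathbf E(A_1\otimes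 A_1)$ have modulus less than one. * (D1) The variables $\eta_{in}$ $(1\le i\le q,\ n\ge1)$ are i.i.d. with a symmetric, continuous, positive density that is nonincreasing on $[0,\infty)$, and all their moments exist. * (D2) $1<\mathbf E(\alpha_{11}-a_1)^{2m}<\infty$ for some $m\in\mathbb N$. * $a_q^2+\sigma_q^2>0$. Let $\lambda>0$ satisfy $\kappa(\lambda)=1$, where $\kappa(\lambda)=\lim_{n\to\infty}(\mathbf E|A_1\cdots A_n|^\lambda)^{1/n}$, and let $h:S\to(0,\infty)$ be continuous with $\mathbf E\big[|x'A_1|^\lambda h(\overline{x'A_1})\big]=h(x)$ for all $x\in S$. For $x\in S$ let $x_0=x$, $v_0=0$, $x_n=\overline{x'A_1\cdots A_n}$ and $v_n=\log|x'A_1\cdots A_n|$ (almost surely well defined). Let $\tilde{\mathbf P}_x$, with expectation $\tilde{\mathbf E}_x$, be the probability measure on the space of paths $(x_n,v_n)_{n\ge0}$ such that $$\tilde{\mathbf E}_xF\big((x_k,v_k)_{k\le n}\big)=\frac1{h(x)}\,\mathbf E\Big[|x'A_1\cdots A_n|^\lambda\,h(x_n)\,F\big((x_k,v_k)_{k\le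 n}\big)\Big]$$ for all $n\ge0$ and all measurable $F\ge0$. For $x\in S$, $t\in\mathbb R$ define $$\tilde G(x,t)=\frac1{h(x)e^t}\int_0^{e^t}u^\lambda\,\mathbf P(x'Y>u)\,du,\qquad g(x,t)=\frac1{h(x)e^t}\int_0^{e^t}u^\lambda\,\psi(x,u)\,du,$$ $$\psi(x,u)=\mathbf P(x'A_1Y_1+x'\zeta_1>u)-\mathbf P(x'A_1Y_1>u).$$ **Proposition 4.4.** The series defining $Y$ and $Y_1$ converge almost surely, the measures $\tilde{\mathbf P}_x$ exist, and for all $x\in S$, $t\in\mathbb R$ the function $\tilde G$ satisfies the Markov renewal equation $$\tilde G(x,t)=\tilde{\mathbf E}_x\tilde G(x_1,t-v_1)+g(x,t)$$ and is given by $$\tilde G(x,t)=\sum_{n=0}^\infty\tilde{\mathbf E}_x\,g(x_n,t-v_n),$$ where all the expectations are of integrable functions and the series converges absolutely. -/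

import Mathlib

open MeasureTheory ProbabilityTheory Filter Topology
open scoped Kronecker ENNReal

noncomputable section

namespace RCAR

/-- Euclidean space of dimension `q = d + 1`, where `q ≥ 1` is the order of the model. -/
abbrev Vec (d : ℕ) : Type := EuclideanSpace ℝ (Fin (d + 1))

abbrev Mat (d : ℕ) : Type := Matrix (Fin (d + 1)) (Fin (d + 1)) ℝ

/-- The unit sphere `S` (two points when `q = 1`). -/
abbrev Sph (d : ℕ) : Type := Metric.sphere (0 : Vec d) 1

/-- The row vector `x' A`. -/
def rowMul {d : ℕ} (x : Vec d) (A : Mat d) : Vec d := WithLp.toLp 2 (Matrix.vecMul x.ofLp A)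

/-- The column vector `A v`. -/
def colMul {d : ℕ} (A : Mat d) (v : Vec d) : Vec d := WithLp.toLp 2 (Matrix.mulVec A v.ofLp)

/-- The matrix norm given by `|A| ^ 2 = tr (A A')`. -/
def matNorm {d : ℕ} (A : Mat d) : ℝ := Real.sqrt (Matrix.trace (A * A.transpose))

/-- The direction `z / |z|` of a nonzero vector; the point `x` is a placeholder for `z = 0`. -/
def dir {d : ℕ} (x : Sph d) (z : Vec d) : Sph d :=
  open Classical in
  if hz : z = 0 then x
  else ⟨‖z‖⁻¹ • z, by
    rw [mem_sphere_zero_iff_norm, norm_smul, norm_inv, norm_norm]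
    exact inv_mul_cancel₀ (norm_ne_zero_iff.2 hz)⟩

/-- The data of a random coefficient autoregressive model
`y_n = α_{1n} y_{n-1} + ⋯ + α_{qn} y_{n-q} + ξ_n`, `α_{in} = a_i + σ_i η_{in}`, `q = d + 1`.
Coefficients are numbered `0, …, d` and times `0, 1, 2, …` instead of from `1` on. -/
structure Model (Ω : Type*) (d : ℕ) where
  a : Fin (d + 1) → ℝ
  σ : Fin (d + 1) → ℝ
  η : Fin (d + 1) → ℕ → Ω → ℝ
  ξ : ℕ → Ω → ℝ

namespace Model

variable {Ω : Type*} {d : ℕ}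

def α (M : Model Ω d) (i : Fin (d + 1)) (n : ℕ) (ω : Ω) : ℝ := M.a i + M.σ i * M.η i n ω

/-- The companion matrix: first row `α_{1n}, …, α_{qn}`, identity block below it. -/
def A (M : Model Ω d) (n : ℕ) (ω : Ω) : Mat d :=
  Matrix.of fun i j => if i = 0 then M.α j n ω else if (j : ℕ) + 1 = (i : ℕ) then 1 else 0

/-- `ζ_n = (ξ_n, 0, …, 0)'`. -/
def ζ (M : Model Ω d) (n : ℕ) (ω : Ω) : Vec d := EuclideanSpace.single 0 (M.ξ n ω)

/-- The product `A_s A_{s+1} ⋯ A_{s+n-1}` of `n` factors. -/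
def prodA (M : Model Ω d) (s : ℕ) : ℕ → Ω → Mat d
  | 0, _ => 1
  | n + 1, ω => prodA M s n ω * M.A (s + n) ω

/-- The terms of the series `ζ_s + ∑_{k ≥ 1} A_s ⋯ A_{s+k-1} ζ_{s+k}`. -/
def yTerm (M : Model Ω d) (s k : ℕ) (ω : Ω) : Vec d := colMul (M.prodA s k ω) (M.ζ (s + k) ω)

/-- The random vector `ζ_s + ∑_{k ≥ 1} A_s ⋯ A_{s+k-1} ζ_{s+k}`. With times numbered from `0`,
`Y 0` is the vector with the stationary law and `Y 1` its copy that does not involve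
`(A_0, ζ_0)`. -/
def Y (M : Model Ω d) (s : ℕ) (ω : Ω) : Vec d := ∑' k, M.yTerm s k ω

/-- `x_n`, the direction of `x' A_0 ⋯ A_{n-1}`. -/
def xs (M : Model Ω d) (x : Sph d) (n : ℕ) (ω : Ω) : Sph d := dir x (rowMul x (M.prodA 0 n ω))

/-- `v_n = log |x' A_0 ⋯ A_{n-1}|`. -/
def vs (M : Model Ω d) (x : Sph d) (n : ℕ) (ω : Ω) : ℝ :=
  Real.log ‖rowMul (x : Vec d) (M.prodA 0 n ω)‖

variable [MeasurableSpace Ω]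

/-- Standing assumptions of the model: the coefficient vectors `η_n` are i.i.d., the noise
variables `ξ_n` are i.i.d., the two sequences are independent, all variables are centered with
unit variance, and `σ_i ≥ 0`. -/
structure Standing (M : Model Ω d) (P : Measure Ω) : Prop where
  σ_nonneg : ∀ i, 0 ≤ M.σ i
  meas_η : ∀ i n, Measurable (M.η i n)
  meas_ξ : ∀ n, Measurable (M.ξ n)
  indep_η : iIndepFun (fun (n : ℕ) (ω : Ω) (i : Fin (d + 1)) => M.η i n ω) P
  ident_η : ∀ n, IdentDistrib (fun ω (i : Fin (d + 1)) => M.η i n ω)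
    (fun ω (i : Fin (d + 1)) => M.η i 0 ω) P P
  indep_ξ : iIndepFun M.ξ P
  ident_ξ : ∀ n, IdentDistrib (M.ξ n) (M.ξ 0) P P
  indep : IndepFun (fun ω (p : Fin (d + 1) × ℕ) => M.η p.1 p.2 ω) (fun ω n => M.ξ n ω) P
  memLp_η : ∀ i, MemLp (M.η i 0) 2 P
  memLp_ξ : MemLp (M.ξ 0) 2 P
  mean_η : ∀ i, ∫ ω, M.η i 0 ω ∂P = 0
  mean_ξ : ∫ ω, M.ξ 0 ω ∂P = 0
  var_η : ∀ i, ∫ ω, M.η i 0 ω ^ 2 ∂P = 1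
  var_ξ : ∫ ω, M.ξ 0 ω ^ 2 ∂P = 1

/-- The matrix `E (A ⊗ A)`. -/
def meanKron (M : Model Ω d) (P : Measure Ω) :
    Matrix (Fin (d + 1) × Fin (d + 1)) (Fin (d + 1) × Fin (d + 1)) ℝ :=
  Matrix.of fun p r => ∫ ω, (M.A 0 ω ⊗ₖ M.A 0 ω) p r ∂P

/-- Every complex eigenvalue of `E (A ⊗ A)` has modulus less than one. -/
def D0 (M : Model Ω d) (P : Measure Ω) : Prop :=
  ∀ z : ℂ, Module.End.HasEigenvalue (Matrix.toLin' ((M.meanKron P).map Complex.ofReal)) z → ‖z‖ < 1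

/-- The variables `η_{in}` are i.i.d. (over `i` and `n`) with a symmetric continuous positive
density that is nonincreasing on `[0, ∞)`, and all their moments exist. -/
structure D1 (M : Model Ω d) (P : Measure Ω) : Prop where
  indep : iIndepFun (fun p : Fin (d + 1) × ℕ => M.η p.1 p.2) P
  density : ∃ φ : ℝ → ℝ, Continuous φ ∧ (∀ s, 0 < φ s) ∧ (∀ s, φ (-s) = φ s) ∧
    AntitoneOn φ (Set.Ici 0) ∧
    ∀ i n, P.map (M.η i n) = volume.withDensity fun s => ENNReal.ofReal (φ s)
  moments : ∀ i n (m : ℕ), Integrable (fun ω => M.η i n ω ^ m) P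

/-- `1 < E (α_{11} - a_1) ^ (2 m) < ∞` for some `m`. -/
def D2 (M : Model Ω d) (P : Measure Ω) : Prop :=
  ∃ m : ℕ, Integrable (fun ω => (M.α 0 0 ω - M.a 0) ^ (2 * m)) P ∧
    1 < ∫ ω, (M.α 0 0 ω - M.a 0) ^ (2 * m) ∂P

/-- `κ(lam) = c`, where `κ(lam) = lim_n (E |A_0 ⋯ A_{n-1}| ^ lam) ^ (1 / n)`. -/
def KappaEq (M : Model Ω d) (P : Measure Ω) (lam c : ℝ) : Prop :=
  Tendsto (fun n : ℕ => (∫ ω, matNorm (M.prodA 0 n ω) ^ lam ∂P) ^ (1 / (n : ℝ))) atTop (𝓝 c)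

/-- The operator `Q_lam(f)(x) = E |x' A| ^ lam f(x' A / |x' A|)`. -/
def Q (M : Model Ω d) (P : Measure Ω) (lam : ℝ) (f : Sph d → ℝ) (x : Sph d) : ℝ :=
  ∫ ω, ‖rowMul (x : Vec d) (M.A 0 ω)‖ ^ lam * f (dir x (rowMul x (M.A 0 ω))) ∂P

/-- `μ` is the law `P̃_x` on path space of the exponentially tilted chain `(x_n, v_n)_{n ≥ 0}`
started at `(x, 0)`: a probability measure with
`Ẽ_x F((x_k, v_k)_{k ≤ n}) = h(x)⁻¹ E [|x' A_0 ⋯ A_{n-1}| ^ lam h(x_n) F((x_k, v_k)_{k ≤ n})]`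
for all `n` and all measurable `F ≥ 0`. There is at most one such `μ`, since its
finite-dimensional distributions are prescribed. -/
structure IsTiltedLaw (M : Model Ω d) (P : Measure Ω) (lam : ℝ) (h : Sph d → ℝ) (x : Sph d)
    (μ : Measure (ℕ → Sph d × ℝ)) : Prop where
  isProb : IsProbabilityMeasure μ
  fdd : ∀ (n : ℕ) (F : (Finset.Iic n → Sph d × ℝ) → ℝ≥0∞), Measurable F →
    ∫⁻ p, F (fun k => p k) ∂μ =
      ∫⁻ ω, ENNReal.ofReal
          ((h x)⁻¹ * (‖rowMul (x : Vec d) (M.prodA 0 n ω)‖ ^ lam * h (M.xs x n ω))) *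
        F (fun k => (M.xs x k ω, M.vs x k ω)) ∂P

/-- The normalized smoothed tail
`G̃(x, t) = (h(x) e ^ t)⁻¹ ∫_0^{e ^ t} u ^ lam P(x' Y > u) du`. -/
def Gt (M : Model Ω d) (P : Measure Ω) (lam : ℝ) (h : Sph d → ℝ) (x : Sph d) (t : ℝ) : ℝ :=
  (h x * Real.exp t)⁻¹ *
    ∫ u in (0 : ℝ)..Real.exp t, u ^ lam * P.real {ω | u < inner ℝ (x : Vec d) (M.Y 0 ω)}

/-- `τ_1 = x' A_0 Y_1`. -/
def τ₁ (M : Model Ω d) (x : Sph d) (ω : Ω) : ℝ :=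
  inner ℝ (x : Vec d) (colMul (M.A 0 ω) (M.Y 1 ω))

/-- `τ_2 = x' ζ_0`. -/
def τ₂ (M : Model Ω d) (x : Sph d) (ω : Ω) : ℝ := inner ℝ (x : Vec d) (M.ζ 0 ω)

/-- `ψ(x, u) = P(τ_1 + τ_2 > u) - P(τ_1 > u)`. -/
def ψ (M : Model Ω d) (P : Measure Ω) (x : Sph d) (u : ℝ) : ℝ :=
  P.real {ω | u < M.τ₁ x ω + M.τ₂ x ω} - P.real {ω | u < M.τ₁ x ω}

/-- The perturbation term `g(x, t) = (h(x) e ^ t)⁻¹ ∫_0^{e ^ t} u ^ lam ψ(x, u) du`. -/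
def g (M : Model Ω d) (P : Measure Ω) (lam : ℝ) (h : Sph d → ℝ) (x : Sph d) (t : ℝ) : ℝ :=
  (h x * Real.exp t)⁻¹ * ∫ u in (0 : ℝ)..Real.exp t, u ^ lam * M.ψ P x u

end Model

end RCAR

end

/-! Let T_n = (h(x)e^t)⁻¹ ∫_0^{e^t} u^lam P(x'A_0⋯A_{n-1}Y_n > u) du (`tailMean`). The proof rests
on two identities, Ẽ_x G̃(x_n, t - v_n) = T_n (`IsTiltedLaw.integral_Gt`) and Ẽ_x g(x_n, t - v_n) =
T_n - T_{n+1} (`IsTiltedLaw.integral_g`), and on ∑ T_n < ∞ (`summable_tailMean`). Given these, the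
renewal equation reads T_0 = T_1 + (T_0 - T_1), and the series telescopes to T_0 = G̃(x, t).

The identities come from scaling. With z = x'A_0⋯A_{n-1}, the factor h(x_n) of the tilt cancels the
normalization of G̃, and |z|^lam times the factor |z| from e^{t - v_n} is exactly what the
substitution u ↦ u/|z| needs to turn the tail of x_n'Y into that of z'Y (`weight_mul_smoothTail`).
Averaging over z, which is independent of Y_n, and using that Y_n has the law of Y gives T_n. Since
Y = ζ_0 + A_0 Y_1 almost surely, g is the smoothed tail of Y minus that of A_0 Y_1; the second term
produces z'A_n Y_{n+1}, hence T_{n+1}.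

For summability, second moments of entries of A_0⋯A_{k-1} are entries of the k-th power of E(A ⊗ A)
(`moment_prodA`), which decay geometrically by (D0). Hence the series for Y converges and
E|A_0⋯A_{n-1}Y_n| decays geometrically; Markov's inequality carries this to T_n because u^{lam-1} is
integrable at 0.

The tilted laws exist by the Ionescu-Tulcea theorem: the equation for h says that the one-step
tilted kernels have mass one. Vanishing products need no separate null-set argument, since they
carry weight 0^lam = 0. -/

noncomputable section

namespace RCAR

/-! ### Geometric decay of matrix powers -/

section PowerBound

attribute [local instance] Matrix.linftyOpNormedRing Matrix.linftyOpNormedAlgebra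

/-- The powers of a matrix all of whose eigenvalues have modulus less than one decay
geometrically. -/
theorem exists_abs_pow_apply_le {n : Type*} [Fintype n] [DecidableEq n] [Nonempty n]
    (K : Matrix n n ℝ)
    (hK : ∀ z : ℂ, Module.End.HasEigenvalue (Matrix.toLin' (K.map Complex.ofReal)) z → ‖z‖ < 1) :
    ∃ C ρ : ℝ, 0 ≤ C ∧ 0 < ρ ∧ ρ < 1 ∧ ∀ k i j, |(K ^ k) i j| ≤ C * ρ ^ k := by
  set B : Matrix n n ℂ := K.map Complex.ofReal with hB
  have hlt : spectralRadius ℂ B < (1 : NNReal) := by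
    refine spectrum.spectralRadius_lt_of_forall_lt B fun z hz => ?_
    have hz' : z ∈ spectrum ℂ (Matrix.toLin' B) := by
      rwa [Matrix.spectrum_toLin']
    exact hK z (Module.End.hasEigenvalue_iff_mem_spectrum.2 hz')
  obtain ⟨r, hr1, hr2⟩ := ENNReal.lt_iff_exists_nnreal_btwn.1 hlt
  have hr2' : r < 1 := by exact_mod_cast hr2
  have hr0 : 0 < r := by
    have := zero_le.trans_lt hr1
    exact_mod_cast this
  -- Gelfand's formula: the k-th roots of the norms tend to the spectral radius, which is below r.
  have hev : ∀ᶠ k : ℕ in atTop, ‖B ^ k‖ ≤ (r : ℝ) ^ k := by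
    filter_upwards [(spectrum.pow_nnnorm_pow_one_div_tendsto_nhds_spectralRadius B).eventually
      (gt_mem_nhds hr1), eventually_gt_atTop 0] with k hk hk0
    have h2 : ((‖B ^ k‖₊ : ℝ≥0∞) ^ (1 / k : ℝ)) ^ (k : ℝ) ≤ (r : ℝ≥0∞) ^ (k : ℝ) :=
      ENNReal.rpow_le_rpow hk.le (by positivity)
    rw [← ENNReal.rpow_mul, one_div, inv_mul_cancel₀ (by positivity), ENNReal.rpow_one,
      ENNReal.rpow_natCast] at h2
    exact_mod_cast h2
  have hO : (fun k : ℕ => B ^ k) =O[atTop] fun k : ℕ => (r : ℝ) ^ k := by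
    refine Asymptotics.IsBigO.of_bound 1 ?_
    filter_upwards [hev] with k hk
    simpa using hk
  -- The constant C absorbs the finitely many initial powers; this uses r ^ k ≠ 0.
  obtain ⟨C, hC0, hC⟩ := Asymptotics.bound_of_isBigO_nat_atTop hO
  refine ⟨C, r, hC0.le, by exact_mod_cast hr0, by exact_mod_cast hr2', fun k i j => ?_⟩
  have hpow : B ^ k = (K ^ k).map Complex.ofReal :=
    (Matrix.map_pow K Complex.ofRealHom k).symm
  have hk : ‖B ^ k‖ ≤ C * (r : ℝ) ^ k := by
    have := hC (x := k) (by positivity)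
    simpa using this
  refine le_trans ?_ hk
  have hentry : ‖(B ^ k) i j‖ ≤ ‖B ^ k‖ := by
    rw [Matrix.linfty_opNorm_def]
    have h1 : ‖(B ^ k) i j‖₊ ≤ ∑ j, ‖(B ^ k) i j‖₊ :=
      Finset.single_le_sum (f := fun j => ‖(B ^ k) i j‖₊) (fun _ _ => zero_le) (Finset.mem_univ j)
    have h2 : ∑ j, ‖(B ^ k) i j‖₊ ≤ Finset.univ.sup fun i => ∑ j, ‖(B ^ k) i j‖₊ :=
      Finset.le_sup (f := fun i => ∑ j, ‖(B ^ k) i j‖₊) (Finset.mem_univ i)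
    exact_mod_cast h1.trans h2
  refine le_trans (le_of_eq ?_) hentry
  rw [hpow]
  simp

end PowerBound

/-! ### Independence of paired sequences -/

/-- If `X_n` are independent, `Y_n` are independent and the two sequences are independent, then
the pairs `(X_n, Y_n)` are independent. -/
theorem iIndepFun_prodMk {Ω β γ : Type*} [MeasurableSpace Ω] [MeasurableSpace β]
    [MeasurableSpace γ] {P : Measure Ω} {X : ℕ → Ω → β} {Y : ℕ → Ω → γ}
    (hX : ∀ n, Measurable (X n)) (hY : ∀ n, Measurable (Y n)) (iX : iIndepFun X P)
    (iY : iIndepFun Y P) (iXY : IndepFun (fun ω n => X n ω) (fun ω n => Y n ω) P) :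
    iIndepFun (fun n ω => (X n ω, Y n ω)) P := by
  rw [iIndepFun_iff_iIndep]
  -- It suffices to check independence on the π-system of preimages of measurable rectangles.
  refine iIndepSets.iIndep (fun n => ((hX n).prodMk (hY n)).comap_le)
    (fun n => Set.preimage (fun ω => (X n ω, Y n ω)) ''
      (Set.image2 (· ×ˢ ·) {s : Set β | MeasurableSet s} {t : Set γ | MeasurableSet t}))
    (fun n => isPiSystem_prod.comap _) (fun n => ?_) ?_
  · rw [← generateFrom_prod, MeasurableSpace.comap_generateFrom]
  · rw [iIndepSets_iff]
    intro S f hf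
    -- The sides are chosen for every n, with dummy values off S, so that they form sequences.
    have hf' : ∀ n, ∃ s t, n ∈ S → MeasurableSet s ∧ MeasurableSet t ∧
        f n = X n ⁻¹' s ∩ Y n ⁻¹' t := by
      intro n
      by_cases hn : n ∈ S
      · obtain ⟨u, ⟨s, hs, t, ht, rfl⟩, hu⟩ := hf n hn
        exact ⟨s, t, fun _ => ⟨hs, ht, by rw [← hu]; rfl⟩⟩
      · exact ⟨∅, ∅, fun h => (hn h).elim⟩
    choose s t hst using hf'
    have h1 : ⋂ n ∈ S, f n = (⋂ n ∈ S, X n ⁻¹' s n) ∩ ⋂ n ∈ S, Y n ⁻¹' t n := by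
      ext ω
      simp only [Set.mem_iInter, Set.mem_inter_iff]
      refine ⟨fun h => ⟨fun n hn => ?_, fun n hn => ?_⟩, fun h n hn => ?_⟩
      · exact ((hst n hn).2.2 ▸ h n hn : ω ∈ X n ⁻¹' s n ∩ Y n ⁻¹' t n).1
      · exact ((hst n hn).2.2 ▸ h n hn : ω ∈ X n ⁻¹' s n ∩ Y n ⁻¹' t n).2
      · exact (hst n hn).2.2 ▸ ⟨h.1 n hn, h.2 n hn⟩
    have hs : ∀ n ∈ S, MeasurableSet (s n) := fun n hn => (hst n hn).1
    have ht : ∀ n ∈ S, MeasurableSet (t n) := fun n hn => (hst n hn).2.1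
    have h2 := iXY.measure_inter_preimage_eq_mul (⋂ n ∈ S, (fun x => x n) ⁻¹' s n)
      (⋂ n ∈ S, (fun x => x n) ⁻¹' t n)
      (Finset.measurableSet_biInter _ fun n hn => measurable_pi_apply n (hs n hn))
      (Finset.measurableSet_biInter _ fun n hn => measurable_pi_apply n (ht n hn))
    simp only [Set.preimage_iInter, ← Set.preimage_comp] at h2
    have h3 := iX.measure_inter_preimage_eq_mul S hs
    have h4 := iY.measure_inter_preimage_eq_mul S ht
    have h5 : ∀ n ∈ S, P (f n) = P (X n ⁻¹' s n) * P (Y n ⁻¹' t n) := fun n hn => by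
      rw [(hst n hn).2.2]
      exact (iXY.comp (measurable_pi_apply n) (measurable_pi_apply n)).measure_inter_preimage_eq_mul
        _ _ (hs n hn) (ht n hn)
    rw [h1, Finset.prod_congr rfl h5, Finset.prod_mul_distrib, ← h3, ← h4]
    exact h2

/-! ### Row and column products: algebra and measurability -/

theorem colMul_apply {d : ℕ} (A : Mat d) (v : Vec d) (i : Fin (d + 1)) :
    colMul A v i = ∑ j, A i j * v j := rfl

theorem rowMul_apply {d : ℕ} (x : Vec d) (A : Mat d) (j : Fin (d + 1)) :
    rowMul x A j = ∑ i, x i * A i j := rfl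

theorem colMul_mul {d : ℕ} (A B : Mat d) (v : Vec d) :
    colMul (A * B) v = colMul A (colMul B v) := by
  simp [colMul, Matrix.mulVec_mulVec]

theorem rowMul_mul {d : ℕ} (x : Vec d) (A B : Mat d) :
    rowMul x (A * B) = rowMul (rowMul x A) B := by
  simp [rowMul, Matrix.vecMul_vecMul]

theorem rowMul_one {d : ℕ} (x : Vec d) : rowMul x (1 : Mat d) = x := by
  simp [rowMul]

theorem colMul_one {d : ℕ} (x : Vec d) : colMul (1 : Mat d) x = x := by
  simp [colMul]

theorem rowMul_smul {d : ℕ} (c : ℝ) (x : Vec d) (A : Mat d) :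
    rowMul (c • x) A = c • rowMul x A := by
  simp [rowMul, Matrix.smul_vecMul]

theorem inner_colMul {d : ℕ} (x : Vec d) (A : Mat d) (v : Vec d) :
    inner ℝ x (colMul A v) = inner ℝ (rowMul x A) v := by
  simp only [PiLp.inner_apply, colMul_apply, rowMul_apply, RCLike.inner_apply, conj_trivial,
    Finset.mul_sum, Finset.sum_mul]
  rw [Finset.sum_comm]
  exact Finset.sum_congr rfl fun i _ => Finset.sum_congr rfl fun j _ => by ring

/-- Left multiplication by a matrix as a continuous linear map. -/
def colMulL {d : ℕ} (A : Mat d) : Vec d →L[ℝ] Vec d :=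
  LinearMap.toContinuousLinearMap
    { toFun := colMul A
      map_add' := fun v w => by simp [colMul, Matrix.mulVec_add]
      map_smul' := fun c v => by simp [colMul, Matrix.mulVec_smul] }

theorem measurable_toVec {β : Type*} {m : MeasurableSpace β} {d : ℕ} {f : β → Vec d}
    (hf : ∀ i, Measurable fun b => f b i) : Measurable f :=
  (WithLp.measurable_toLp 2 _).comp (measurable_pi_lambda (fun b => (f b).ofLp) hf)

theorem measurable_coord {d : ℕ} (i : Fin (d + 1)) : Measurable fun v : Vec d => v i :=
  (measurable_pi_apply i).comp (WithLp.measurable_ofLp 2 _)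

theorem measurable_colMul {β : Type*} {m : MeasurableSpace β} {d : ℕ} {A : β → Mat d}
    {v : β → Vec d} (hA : ∀ i j, Measurable fun b => A b i j) (hv : Measurable v) :
    Measurable fun b => colMul (A b) (v b) :=
  measurable_toVec fun i => by
    simp only [colMul_apply]
    exact Finset.measurable_sum _ fun j _ => (hA i j).mul ((measurable_coord j).comp hv)

theorem measurable_rowMul {β : Type*} {m : MeasurableSpace β} {d : ℕ} {A : β → Mat d}
    {v : β → Vec d} (hA : ∀ i j, Measurable fun b => A b i j) (hv : Measurable v) :
    Measurable fun b => rowMul (v b) (A b) :=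
  measurable_toVec fun i => by
    simp only [rowMul_apply]
    exact Finset.measurable_sum _ fun j _ => ((measurable_coord j).comp hv).mul (hA j i)

/-! ### Noise paths, past and future -/

namespace Model

variable {Ω : Type*} {d : ℕ}

/-- The noise at time `n`: coefficient noise and additive noise. -/
def noise (M : Model Ω d) (n : ℕ) (ω : Ω) : (Fin (d + 1) → ℝ) × ℝ :=
  (fun i => M.η i n ω, M.ξ n ω)

/-- The companion matrix as a function of the coefficient noise. -/
def companion (M : Model Ω d) (e : Fin (d + 1) → ℝ) : Mat d :=
  Matrix.of fun i j => if i = 0 then M.a j + M.σ j * e j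
    else if (j : ℕ) + 1 = (i : ℕ) then 1 else 0

theorem A_eq_companion (M : Model Ω d) (n : ℕ) (ω : Ω) :
    M.A n ω = M.companion (M.noise n ω).1 := rfl

/-- The matrix products as functions of a noise path. -/
def pathProd (M : Model Ω d) (w : ℕ → (Fin (d + 1) → ℝ) × ℝ) : ℕ → Mat d
  | 0 => 1
  | n + 1 => M.pathProd w n * M.companion (w n).1

/-- The series `Y` as a function of a noise path. -/
def pathY (M : Model Ω d) (w : ℕ → (Fin (d + 1) → ℝ) × ℝ) : Vec d :=
  ∑' k, colMul (M.pathProd w k) (EuclideanSpace.single 0 (w k).2)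

theorem prodA_eq_pathProd (M : Model Ω d) (s k : ℕ) (ω : Ω) :
    M.prodA s k ω = M.pathProd (fun j => M.noise (s + j) ω) k := by
  induction k with
  | zero => rfl
  | succ k ih => rw [prodA, pathProd, ih]; rfl

/-- One fixed function of the shifted noise serves all s, so stationarity of the noise passes to the
vectors `Y s`. -/
theorem Y_eq_pathY (M : Model Ω d) (s : ℕ) (ω : Ω) :
    M.Y s ω = M.pathY fun j => M.noise (s + j) ω := by
  simp only [Y, pathY, yTerm, prodA_eq_pathProd]
  rfl

theorem prodA_add (M : Model Ω d) (s m k : ℕ) (ω : Ω) :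
    M.prodA s (m + k) ω = M.prodA s m ω * M.prodA (s + m) k ω := by
  induction k with
  | zero => simp [prodA]
  | succ k ih => rw [← add_assoc, prodA, ih, prodA, mul_assoc, add_assoc]

theorem yTerm_add (M : Model Ω d) (m k : ℕ) (ω : Ω) :
    M.yTerm 0 (m + k) ω = colMul (M.prodA 0 m ω) (M.yTerm m k ω) := by
  simp only [yTerm, prodA_add, colMul_mul, zero_add]

theorem yTerm_zero (M : Model Ω d) (s : ℕ) (ω : Ω) : M.yTerm s 0 ω = M.ζ s ω := by
  simp [yTerm, prodA, colMul_one]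

theorem yTerm_succ (M : Model Ω d) (s k : ℕ) (ω : Ω) :
    M.yTerm s (k + 1) ω = colMul (M.A s ω) (M.yTerm (s + 1) k ω) := by
  have h1 : M.prodA s 1 ω = M.A s ω := by simp [prodA]
  simp only [yTerm]
  rw [add_comm k 1, prodA_add, colMul_mul, h1, add_assoc]

theorem yTerm_apply (M : Model Ω d) (s k : ℕ) (ω : Ω) (i : Fin (d + 1)) :
    M.yTerm s k ω i = M.prodA s k ω i 0 * M.ξ (s + k) ω := by
  simp [yTerm, colMul_apply, ζ]

theorem measurable_companion (M : Model Ω d) (i j : Fin (d + 1)) :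
    Measurable fun e => M.companion e i j := by
  simp only [companion, Matrix.of_apply]
  split_ifs <;> fun_prop

theorem measurable_pathProd (M : Model Ω d) (k : ℕ) (i j : Fin (d + 1)) :
    Measurable fun w => M.pathProd w k i j := by
  induction k generalizing i j with
  | zero => exact measurable_const
  | succ k ih =>
    simp only [pathProd, Matrix.mul_apply]
    exact Finset.measurable_sum _ fun l _ => (ih i l).mul
      ((M.measurable_companion l j).comp (measurable_fst.comp (measurable_pi_apply k)))

theorem measurable_single_zero :
    Measurable fun s : ℝ => (EuclideanSpace.single 0 s : Vec d) :=
  measurable_toVec fun i => by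
    by_cases hi : i = 0
    · subst hi; simpa using measurable_id'
    · simp [hi]

theorem measurable_pathY (M : Model Ω d) : Measurable M.pathY :=
  Measurable.tsum fun k => measurable_colMul (M.measurable_pathProd k)
    (measurable_single_zero.comp (measurable_snd.comp (measurable_pi_apply k)))

/-- The information of the times before `n`. -/
@[reducible]
def past (M : Model Ω d) (n : ℕ) : MeasurableSpace Ω :=
  ⨆ k ∈ Set.Iio n, MeasurableSpace.comap (M.noise k) inferInstance

/-- The information of the times from `n` on. -/
@[reducible]
def future (M : Model Ω d) (n : ℕ) : MeasurableSpace Ω :=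
  ⨆ k ∈ Set.Ici n, MeasurableSpace.comap (M.noise k) inferInstance

theorem measurable_noise_past (M : Model Ω d) {k n : ℕ} (hk : k < n) :
    Measurable[M.past n] (M.noise k) :=
  measurable_iff_comap_le.2 (le_iSup₂_of_le k hk le_rfl)

theorem measurable_noise_future (M : Model Ω d) {k n : ℕ} (hk : n ≤ k) :
    Measurable[M.future n] (M.noise k) :=
  measurable_iff_comap_le.2 (le_iSup₂_of_le k hk le_rfl)

theorem measurable_A_future (M : Model Ω d) {k n : ℕ} (hk : n ≤ k) (i j : Fin (d + 1)) :
    Measurable[M.future n] fun ω => M.A k ω i j :=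
  (M.measurable_companion i j).comp (measurable_fst.comp (M.measurable_noise_future hk))

theorem measurable_shift_future (M : Model Ω d) {s n : ℕ} (hs : n ≤ s) :
    Measurable[M.future n] fun ω j => M.noise (s + j) ω :=
  @measurable_pi_lambda _ _ _ (M.future n) _ _ fun j =>
    M.measurable_noise_future (hs.trans (Nat.le_add_right s j))

theorem measurable_Y_future (M : Model Ω d) {s n : ℕ} (hs : n ≤ s) :
    Measurable[M.future n] (M.Y s) := by
  rw [funext (M.Y_eq_pathY s)]
  exact M.measurable_pathY.comp (M.measurable_shift_future hs)

theorem measurable_prodA_past (M : Model Ω d) {s k n : ℕ} (h : s + k ≤ n) (i j : Fin (d + 1)) :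
    Measurable[M.past n] fun ω => M.prodA s k ω i j := by
  induction k generalizing i j with
  | zero => exact measurable_const
  | succ k ih =>
    simp only [prodA, Matrix.mul_apply]
    refine Finset.measurable_sum _ fun l _ => (ih (by omega) i l).mul ?_
    exact (M.measurable_companion l j).comp
      (measurable_fst.comp (M.measurable_noise_past (by omega)))

theorem measurable_rowMul_prodA_past (M : Model Ω d) (x : Vec d) {k n : ℕ} (h : k ≤ n) :
    Measurable[M.past n] fun ω => rowMul x (M.prodA 0 k ω) :=
  measurable_rowMul (M.measurable_prodA_past (by omega)) measurable_const

variable [MeasurableSpace Ω] {M : Model Ω d} {P : Measure Ω}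

namespace Standing

theorem measurable_noise (hM : M.Standing P) (n : ℕ) : Measurable (M.noise n) :=
  (measurable_pi_lambda _ fun i => hM.meas_η i n).prodMk (hM.meas_ξ n)

theorem past_le (hM : M.Standing P) (n : ℕ) : M.past n ≤ ‹MeasurableSpace Ω› :=
  iSup₂_le fun k _ => (hM.measurable_noise k).comap_le

theorem future_le (hM : M.Standing P) (n : ℕ) : M.future n ≤ ‹MeasurableSpace Ω› :=
  iSup₂_le fun k _ => (hM.measurable_noise k).comap_le

theorem iIndepFun_noise (hM : M.Standing P) : iIndepFun M.noise P := by
  refine iIndepFun_prodMk (fun n => measurable_pi_lambda _ fun i => hM.meas_η i n) hM.meas_ξ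
    hM.indep_η hM.indep_ξ ?_
  exact hM.indep.comp (φ := fun (f : Fin (d + 1) × ℕ → ℝ) (n : ℕ) (i : Fin (d + 1)) => f (i, n))
    (measurable_pi_lambda _ fun n => measurable_pi_lambda _ fun i => measurable_pi_apply (i, n))
    measurable_id

theorem indep_past_future (hM : M.Standing P) (n : ℕ) : Indep (M.past n) (M.future n) P :=
  indep_iSup_of_disjoint (fun k => (hM.measurable_noise k).comap_le)
    ((iIndepFun_iff_iIndep _ _ _).1 hM.iIndepFun_noise)
    (Set.disjoint_left.2 fun k (hk : k < n) (hk' : n ≤ k) => by omega)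

theorem indepFun_past_future (hM : M.Standing P) {n : ℕ} {β γ : Type*} [mβ : MeasurableSpace β]
    [mγ : MeasurableSpace γ] {f : Ω → β} {g : Ω → γ} (hf : Measurable[M.past n] f)
    (hg : Measurable[M.future n] g) : IndepFun f g P :=
  (IndepFun_iff_Indep _ _ _).2
    (indep_of_indep_of_le (hM.indep_past_future n) hf.comap_le hg.comap_le)

theorem map_noise [IsProbabilityMeasure P] (hM : M.Standing P) (n : ℕ) :
    P.map (M.noise n) = P.map (M.noise 0) := by
  have key : ∀ n, P.map (M.noise n) =
      (P.map fun ω i => M.η i n ω).prod (P.map (M.ξ n)) := fun n =>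
    (indepFun_iff_map_prod_eq_prod_map_map
      (measurable_pi_lambda _ fun i => hM.meas_η i n).aemeasurable
      (hM.meas_ξ n).aemeasurable).1 (hM.indep.comp
        (φ := fun (f : Fin (d + 1) × ℕ → ℝ) (i : Fin (d + 1)) => f (i, n))
        (ψ := fun f : ℕ → ℝ => f n)
        (measurable_pi_lambda _ fun i => measurable_pi_apply (i, n)) (measurable_pi_apply n))
  rw [key, key, (hM.ident_η n).map_eq, (hM.ident_ξ n).map_eq]

/-- Stationarity: both sides are the infinite product of the common law of the noise. -/
theorem map_shift [IsProbabilityMeasure P] (hM : M.Standing P) (s : ℕ) :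
    P.map (fun ω j => M.noise (s + j) ω) = P.map fun ω j => M.noise j ω := by
  rw [iIndepFun.map_fun_eq_infinitePi_map hM.measurable_noise hM.iIndepFun_noise,
    iIndepFun.map_fun_eq_infinitePi_map (X := fun j => M.noise (s + j))
      (fun j => hM.measurable_noise _)
      (hM.iIndepFun_noise.precomp (g := fun j => s + j) (add_right_injective s))]
  simp only [hM.map_noise (_ + _)]
  congr 1
  ext1 j
  rw [hM.map_noise j]

end Standing

end Model

/-! ### Moments of the products and convergence of the series -/

namespace Model

variable {Ω : Type*} {d : ℕ} [MeasurableSpace Ω] {M : Model Ω d} {P : Measure Ω}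

namespace Standing

theorem measurable_prodA (hM : M.Standing P) (s k : ℕ) (i j : Fin (d + 1)) :
    Measurable fun ω => M.prodA s k ω i j :=
  (M.measurable_prodA_past le_rfl i j).mono (hM.past_le _) le_rfl

theorem measurable_Y (hM : M.Standing P) (s : ℕ) : Measurable (M.Y s) :=
  (M.measurable_Y_future le_rfl).mono (hM.future_le s) le_rfl

theorem measurable_yTerm (hM : M.Standing P) (s k : ℕ) : Measurable (M.yTerm s k) :=
  measurable_colMul (hM.measurable_prodA s k) (measurable_single_zero.comp (hM.meas_ξ _))

theorem memLp_A [IsProbabilityMeasure P] (hM : M.Standing P) (n : ℕ) (i j : Fin (d + 1)) :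
    MemLp (fun ω => M.A n ω i j) 2 P := by
  have hη : MemLp (fun ω => M.η j n ω) 2 P :=
    ((hM.ident_η n).comp (measurable_pi_apply j)).symm.memLp_snd (hM.memLp_η j)
  simp only [A, Matrix.of_apply, α]
  split_ifs
  · exact (memLp_const (M.a j)).add (hη.const_mul (M.σ j))
  · exact memLp_const _
  · exact memLp_const _

theorem integral_A_mul_A (hM : M.Standing P) (n : ℕ) (i j i' j' : Fin (d + 1)) :
    ∫ ω, M.A n ω i j * M.A n ω i' j' ∂P = M.meanKron P (i, i') (j, j') := by
  have hid := (hM.ident_η n).comp (u := fun e => M.companion e i j * M.companion e i' j')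
    ((M.measurable_companion i j).mul (M.measurable_companion i' j'))
  exact hid.integral_eq

/-- The Kronecker square of a product is the product of the Kronecker squares, and independence of
the factors turns its mean into a matrix power. The induction splits off the last factor, which
belongs to the future of the others. -/
theorem moment_prodA [IsProbabilityMeasure P] (hM : M.Standing P) (s k : ℕ)
    (i j i' j' : Fin (d + 1)) :
    Integrable (fun ω => M.prodA s k ω i j * M.prodA s k ω i' j') P ∧
      ∫ ω, M.prodA s k ω i j * M.prodA s k ω i' j' ∂P = (M.meanKron P ^ k) (i, i') (j, j') := by
  induction k generalizing j j' with
  | zero =>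
    simp only [prodA, pow_zero, Matrix.one_apply, Prod.mk.injEq]
    refine ⟨integrable_const _, ?_⟩
    by_cases h1 : i = j <;> by_cases h2 : i' = j' <;> simp [h1, h2]
  | succ k ih =>
    have hexp : ∀ ω, M.prodA s (k + 1) ω i j * M.prodA s (k + 1) ω i' j' =
        ∑ p : Fin (d + 1) × Fin (d + 1), (M.prodA s k ω i p.1 * M.prodA s k ω i' p.2) *
          (M.A (s + k) ω p.1 j * M.A (s + k) ω p.2 j') := fun ω => by
      simp only [prodA, Matrix.mul_apply, Finset.sum_mul_sum, Fintype.sum_prod_type]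
      exact Finset.sum_congr rfl fun _ _ => Finset.sum_congr rfl fun _ _ => by ring
    have hind : ∀ p : Fin (d + 1) × Fin (d + 1),
        IndepFun (fun ω => M.prodA s k ω i p.1 * M.prodA s k ω i' p.2)
          (fun ω => M.A (s + k) ω p.1 j * M.A (s + k) ω p.2 j') P := fun p =>
      hM.indepFun_past_future (n := s + k)
        ((M.measurable_prodA_past le_rfl i p.1).mul (M.measurable_prodA_past le_rfl i' p.2))
        ((M.measurable_A_future le_rfl p.1 j).mul (M.measurable_A_future le_rfl p.2 j'))
    have hA : ∀ p : Fin (d + 1) × Fin (d + 1),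
        Integrable (fun ω => M.A (s + k) ω p.1 j * M.A (s + k) ω p.2 j') P := fun p =>
      (hM.memLp_A (s + k) p.1 j).integrable_mul (hM.memLp_A (s + k) p.2 j')
    have hint : ∀ p : Fin (d + 1) × Fin (d + 1),
        Integrable (fun ω => (M.prodA s k ω i p.1 * M.prodA s k ω i' p.2) *
          (M.A (s + k) ω p.1 j * M.A (s + k) ω p.2 j')) P := fun p =>
      (hind p).integrable_mul (ih p.1 p.2).1 (hA p)
    simp only [hexp]
    refine ⟨integrable_finsetSum _ fun p _ => hint p, ?_⟩
    rw [integral_finsetSum _ fun p _ => hint p, pow_succ, Matrix.mul_apply]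
    refine Finset.sum_congr rfl fun p _ => ?_
    have h := (hind p).integral_fun_mul_eq_mul_integral (ih p.1 p.2).1.aestronglyMeasurable
      (hA p).aestronglyMeasurable
    rw [h, (ih p.1 p.2).2, hM.integral_A_mul_A]

theorem lintegral_ξ_sq [IsProbabilityMeasure P] (hM : M.Standing P) (n : ℕ) :
    ∫⁻ ω, ENNReal.ofReal (M.ξ n ω ^ 2) ∂P = 1 := by
  have hid := (hM.ident_ξ n).comp (u := fun y => y ^ 2) (by fun_prop)
  have h0 : Integrable (fun ω => M.ξ 0 ω ^ 2) P := hM.memLp_ξ.integrable_sq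
  have h1 : Integrable (fun ω => M.ξ n ω ^ 2) P := hid.symm.integrable_snd h0
  rw [← ofReal_integral_eq_lintegral_ofReal h1 (ae_of_all _ fun _ => sq_nonneg _)]
  have h2 : ∫ ω, M.ξ n ω ^ 2 ∂P = ∫ ω, M.ξ 0 ω ^ 2 ∂P := hid.integral_eq
  rw [h2, hM.var_ξ, ENNReal.ofReal_one]

/-- The terms of the series decay geometrically in mean. -/
theorem exists_lintegral_yTerm_le [IsProbabilityMeasure P] (hM : M.Standing P) (hD0 : M.D0 P) :
    ∃ C r : ℝ, 0 ≤ C ∧ 0 < r ∧ r < 1 ∧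
      ∀ s k, ∫⁻ ω, ‖M.yTerm s k ω‖ₑ ∂P ≤ ENNReal.ofReal (C * r ^ k) := by
  obtain ⟨C, ρ, hC, hρ0, hρ1, hb⟩ := exists_abs_pow_apply_le (M.meanKron P) hD0
  set r := Real.sqrt ρ with hr
  have hr0 : 0 < r := Real.sqrt_pos.2 hρ0
  have hr1 : r < 1 := by rw [hr, Real.sqrt_lt' one_pos]; simpa using hρ1
  have hrr : r * r = ρ := Real.mul_self_sqrt hρ0.le
  -- There are d + 1 coordinates; in each, C comes from the matrix product and 1 from the unit
  -- variance of the noise.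
  refine ⟨(d + 1) * (C + 1), r, by positivity, hr0, hr1, fun s k => ?_⟩
  have hrk : 0 < r ^ k := pow_pos hr0 k
  have hpt : ∀ ω, ‖M.yTerm s k ω‖ₑ ≤ ∑ i : Fin (d + 1),
      (ENNReal.ofReal ((r ^ k)⁻¹) * ENNReal.ofReal (M.prodA s k ω i 0 * M.prodA s k ω i 0) +
        ENNReal.ofReal (r ^ k) * ENNReal.ofReal (M.ξ (s + k) ω ^ 2)) := fun ω => by
    have h1 : ‖M.yTerm s k ω‖ ≤ ∑ i, |M.yTerm s k ω i| := by
      rw [EuclideanSpace.norm_eq]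
      refine Real.sqrt_le_iff.2 ⟨Finset.sum_nonneg fun _ _ => abs_nonneg _, ?_⟩
      simpa only [Real.norm_eq_abs] using
        Finset.sum_sq_le_sq_sum_of_nonneg (s := Finset.univ) fun i _ => abs_nonneg (M.yTerm s k ω i)
    have h2 : ∀ i, |M.yTerm s k ω i| ≤ (r ^ k)⁻¹ * (M.prodA s k ω i 0 * M.prodA s k ω i 0) +
        r ^ k * M.ξ (s + k) ω ^ 2 := fun i => by
      rw [yTerm_apply]
      generalize M.prodA s k ω i 0 = p
      generalize M.ξ (s + k) ω = y
      -- A weighted arithmetic-geometric mean inequality. As E p² ≤ C ρ ^ k = C r ^ (2k), the weight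
      -- r ^ k leaves both terms of order r ^ k.
      have h3 : (r ^ k)⁻¹ * (p * p) + r ^ k * y ^ 2 - |p * y| =
          (r ^ k)⁻¹ * ((|p| - r ^ k * |y|) ^ 2 + r ^ k * |p| * |y|) := by
        rw [abs_mul, ← abs_mul_abs_self p, ← sq_abs y]
        field_simp
        ring
      have h4 : 0 ≤ (r ^ k)⁻¹ * ((|p| - r ^ k * |y|) ^ 2 + r ^ k * |p| * |y|) := by positivity
      linarith
    rw [← ofReal_norm]
    refine (ENNReal.ofReal_le_ofReal (h1.trans (Finset.sum_le_sum fun i _ => h2 i))).trans ?_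
    rw [ENNReal.ofReal_sum_of_nonneg fun i _ => by
      have := mul_self_nonneg (M.prodA s k ω i 0); positivity]
    refine Finset.sum_le_sum fun i _ => ?_
    rw [ENNReal.ofReal_add (by have := mul_self_nonneg (M.prodA s k ω i 0); positivity)
      (by positivity), ENNReal.ofReal_mul (by positivity), ENNReal.ofReal_mul hrk.le]
  refine (lintegral_mono hpt).trans ?_
  have hm1 : ∀ i, Measurable fun ω =>
      ENNReal.ofReal (M.prodA s k ω i 0 * M.prodA s k ω i 0) := fun i =>
    ((hM.measurable_prodA s k i 0).mul (hM.measurable_prodA s k i 0)).ennreal_ofReal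
  have hm2 : Measurable fun ω => ENNReal.ofReal (M.ξ (s + k) ω ^ 2) :=
    ((hM.meas_ξ _).pow_const 2).ennreal_ofReal
  rw [lintegral_finsetSum Finset.univ (f := fun i ω => ENNReal.ofReal ((r ^ k)⁻¹) *
      ENNReal.ofReal (M.prodA s k ω i 0 * M.prodA s k ω i 0) +
        ENNReal.ofReal (r ^ k) * ENNReal.ofReal (M.ξ (s + k) ω ^ 2))
    fun i _ => ((hm1 i).const_mul _).add (hm2.const_mul _)]
  have hterm : ∀ i : Fin (d + 1), ∫⁻ ω, (ENNReal.ofReal ((r ^ k)⁻¹) *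
      ENNReal.ofReal (M.prodA s k ω i 0 * M.prodA s k ω i 0) +
        ENNReal.ofReal (r ^ k) * ENNReal.ofReal (M.ξ (s + k) ω ^ 2)) ∂P ≤
      ENNReal.ofReal ((C + 1) * r ^ k) := fun i => by
    rw [lintegral_add_left ((hm1 i).const_mul _), lintegral_const_mul _ (hm1 i),
      lintegral_const_mul _ hm2, hM.lintegral_ξ_sq, mul_one,
      ← ofReal_integral_eq_lintegral_ofReal (hM.moment_prodA s k i 0 i 0).1
        (ae_of_all _ fun _ => mul_self_nonneg _), (hM.moment_prodA s k i 0 i 0).2,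
      ← ENNReal.ofReal_mul (by positivity), add_mul, one_mul,
      ENNReal.ofReal_add (by positivity) hrk.le]
    refine add_le_add (ENNReal.ofReal_le_ofReal ?_) le_rfl
    calc (r ^ k)⁻¹ * (M.meanKron P ^ k) (i, i) (0, 0) ≤ (r ^ k)⁻¹ * (C * ρ ^ k) := by
          gcongr
          exact (le_abs_self _).trans (hb _ _ _)
      _ = C * r ^ k := by
          rw [← hrr, mul_pow]
          field_simp
  refine (Finset.sum_le_sum fun i _ => hterm i).trans (le_of_eq ?_)
  rw [Finset.sum_const, Finset.card_univ, Fintype.card_fin, nsmul_eq_mul,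
    ← ENNReal.ofReal_natCast, ← ENNReal.ofReal_mul (by positivity)]
  push_cast
  ring_nf

theorem lintegral_tsum_yTerm_le [IsProbabilityMeasure P] (hM : M.Standing P) {C r : ℝ}
    (hC : 0 ≤ C) (hr0 : 0 < r) (hr1 : r < 1)
    (hb : ∀ s k, ∫⁻ ω, ‖M.yTerm s k ω‖ₑ ∂P ≤ ENNReal.ofReal (C * r ^ k)) (s n : ℕ) :
    ∫⁻ ω, ∑' k, ‖M.yTerm s (n + k) ω‖ₑ ∂P ≤ ENNReal.ofReal (C * (1 - r)⁻¹ * r ^ n) := by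
  rw [lintegral_tsum fun k => (hM.measurable_yTerm s (n + k)).enorm.aemeasurable]
  refine (ENNReal.tsum_le_tsum fun k => hb s (n + k)).trans (le_of_eq ?_)
  have hs : HasSum (fun k => C * r ^ (n + k)) (C * (1 - r)⁻¹ * r ^ n) := by
    have h := (hasSum_geometric_of_lt_one hr0.le hr1).mul_left (C * r ^ n)
    have e1 : (fun k => C * r ^ (n + k)) = fun k => C * r ^ n * r ^ k := by
      ext k
      rw [pow_add, mul_assoc]
    rwa [e1, mul_right_comm]
  rw [← ENNReal.ofReal_tsum_of_nonneg (fun k => by positivity) hs.summable, hs.tsum_eq]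

theorem ae_summable_yTerm [IsProbabilityMeasure P] (hM : M.Standing P) (hD0 : M.D0 P) (s : ℕ) :
    ∀ᵐ ω ∂P, Summable fun k => M.yTerm s k ω := by
  obtain ⟨C, r, hC, hr0, hr1, hb⟩ := hM.exists_lintegral_yTerm_le hD0
  have h := hM.lintegral_tsum_yTerm_le hC hr0 hr1 hb s 0
  simp only [zero_add] at h
  have hm : Measurable fun ω => ∑' k, ‖M.yTerm s k ω‖ₑ :=
    Measurable.tsum fun k => (hM.measurable_yTerm s k).enorm
  filter_upwards [ae_lt_top hm (h.trans_lt ENNReal.ofReal_lt_top).ne] with ω hω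
  have := ENNReal.summable_toReal hω.ne
  simp only [toReal_enorm] at this
  exact this.of_norm

/-- The zeroth term is split off and the matrix is pulled out of the remaining series by continuity;
summability of both series is what makes this only an almost sure statement. -/
theorem ae_Y_eq [IsProbabilityMeasure P] (hM : M.Standing P) (hD0 : M.D0 P) (s : ℕ) :
    ∀ᵐ ω ∂P, M.Y s ω = M.ζ s ω + colMul (M.A s ω) (M.Y (s + 1) ω) := by
  filter_upwards [hM.ae_summable_yTerm hD0 s, hM.ae_summable_yTerm hD0 (s + 1)] with ω h0 h1
  rw [Y, h0.tsum_eq_zero_add, yTerm_zero]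
  congr 1
  simp only [yTerm_succ]
  exact ((colMulL (M.A s ω)).map_tsum h1).symm

/-- The remainders of the series decay geometrically in mean. -/
theorem exists_lintegral_remainder_le [IsProbabilityMeasure P] (hM : M.Standing P)
    (hD0 : M.D0 P) : ∃ C r : ℝ, 0 ≤ C ∧ 0 < r ∧ r < 1 ∧
      ∀ n, ∫⁻ ω, ‖colMul (M.prodA 0 n ω) (M.Y n ω)‖ₑ ∂P ≤ ENNReal.ofReal (C * r ^ n) := by
  obtain ⟨C, r, hC, hr0, hr1, hb⟩ := hM.exists_lintegral_yTerm_le hD0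
  refine ⟨C * (1 - r)⁻¹, r, mul_nonneg hC (inv_nonneg.2 (by linarith)), hr0, hr1, fun n => ?_⟩
  refine le_trans (lintegral_mono_ae ?_) (hM.lintegral_tsum_yTerm_le hC hr0 hr1 hb 0 n)
  filter_upwards [hM.ae_summable_yTerm hD0 n] with ω hω
  have h1 : colMul (M.prodA 0 n ω) (M.Y n ω) = ∑' k, M.yTerm 0 (n + k) ω := by
    simp only [yTerm_add]
    exact (colMulL (M.prodA 0 n ω)).map_tsum hω
  rw [h1]
  exact enorm_tsum_le_tsum_enorm

end Standing

end Model

/-! ### Directions and the tilted chain -/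

theorem coe_dir {d : ℕ} (x : Sph d) {z : Vec d} (hz : z ≠ 0) : (dir x z : Vec d) = ‖z‖⁻¹ • z := by
  simp [dir, hz]

theorem dir_self {d : ℕ} (x : Sph d) : dir x (x : Vec d) = x := by
  have hx : ‖(x : Vec d)‖ = 1 := mem_sphere_zero_iff_norm.1 x.2
  have hx0 : (x : Vec d) ≠ 0 := norm_ne_zero_iff.1 (by rw [hx]; exact one_ne_zero)
  exact Subtype.ext (by rw [coe_dir x hx0, hx, inv_one, one_smul])

theorem norm_smul_dir {d : ℕ} (x : Sph d) (z : Vec d) : ‖z‖ • (dir x z : Vec d) = z := by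
  by_cases hz : z = 0
  · simp [hz]
  · rw [coe_dir x hz, smul_smul, mul_inv_cancel₀ (norm_ne_zero_iff.2 hz), one_smul]

theorem dir_smul {d : ℕ} (x y : Sph d) {c : ℝ} (hc : 0 < c) {z : Vec d} (hz : z ≠ 0) :
    dir x (c • z) = dir y z := by
  refine Subtype.ext ?_
  rw [coe_dir x (smul_ne_zero hc.ne' hz), coe_dir y hz, norm_smul, Real.norm_of_nonneg hc.le,
    smul_smul, mul_inv, mul_right_comm, inv_mul_cancel₀ hc.ne', one_mul]

theorem measurable_dir {β : Type*} {m : MeasurableSpace β} {d : ℕ} {x : β → Sph d}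
    {z : β → Vec d} (hx : Measurable x) (hz : Measurable z) :
    Measurable fun b => dir (x b) (z b) := by
  have h : ∀ b, (dir (x b) (z b) : Vec d) =
      open Classical in if z b = 0 then (x b : Vec d) else ‖z b‖⁻¹ • z b := fun b => by
    by_cases hb : z b = 0
    · simp [dir, hb]
    · simp [dir, hb]
  have h2 : Measurable fun b => (dir (x b) (z b) : Vec d) := by
    simp only [h]
    exact Measurable.ite (hz (measurableSet_singleton 0)) (measurable_subtype_coe.comp hx)
      (hz.norm.inv.smul hz)
  exact h2.subtype_mk (h := fun b => (dir (x b) (z b)).2)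

/-- Integration of a function of two independent variables. -/
theorem lintegral_comp_prodMk_of_indepFun {Ω β γ : Type*} [MeasurableSpace Ω] [MeasurableSpace β]
    [MeasurableSpace γ] {P : Measure Ω} [IsProbabilityMeasure P] {U : Ω → β} {V : Ω → γ}
    (hUV : IndepFun U V P) (hU : Measurable U) (hV : Measurable V) {φ : β × γ → ℝ≥0∞}
    (hφ : Measurable φ) :
    ∫⁻ ω, φ (U ω, V ω) ∂P = ∫⁻ ω, ∫⁻ v, φ (U ω, v) ∂(P.map V) ∂P := by
  have : IsProbabilityMeasure (P.map V) := Measure.isProbabilityMeasure_map hV.aemeasurable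
  have : IsProbabilityMeasure (P.map U) := Measure.isProbabilityMeasure_map hU.aemeasurable
  rw [← lintegral_map hφ (hU.prodMk hV),
    (indepFun_iff_map_prod_eq_prod_map_map hU.aemeasurable hV.aemeasurable).1 hUV,
    lintegral_prod _ hφ.aemeasurable, lintegral_map hφ.lintegral_prod_right' hU]

namespace Model

variable {Ω : Type*} {d : ℕ}

/-- The density of the tilted law of the coefficient noise, given the current direction. -/
def tiltDensity (M : Model Ω d) (lam : ℝ) (h : Sph d → ℝ) (x : Sph d) (e : Fin (d + 1) → ℝ) :
    ℝ≥0∞ :=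
  ENNReal.ofReal ((h x)⁻¹ * (‖rowMul (x : Vec d) (M.companion e)‖ ^ lam *
    h (dir x (rowMul (x : Vec d) (M.companion e)))))

/-- One step of the chain of directions and logarithmic lengths. -/
def chainStep (M : Model Ω d) (p : Sph d × ℝ) (e : Fin (d + 1) → ℝ) : Sph d × ℝ :=
  (dir p.1 (rowMul (p.1 : Vec d) (M.companion e)),
    p.2 + Real.log ‖rowMul (p.1 : Vec d) (M.companion e)‖)

/-- The weight that defines the tilted law up to time `n`. -/
def tiltWeight (M : Model Ω d) (lam : ℝ) (h : Sph d → ℝ) (x : Sph d) (n : ℕ) (ω : Ω) : ℝ≥0∞ :=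
  ENNReal.ofReal ((h x)⁻¹ * (‖rowMul (x : Vec d) (M.prodA 0 n ω)‖ ^ lam * h (M.xs x n ω)))

/-- The chain up to time `n`. -/
def chain (M : Model Ω d) (x : Sph d) (n : ℕ) (ω : Ω) : Finset.Iic n → Sph d × ℝ :=
  fun k => (M.xs x k ω, M.vs x k ω)

theorem measurable_rowMul_companion (M : Model Ω d) :
    Measurable fun b : (Sph d × ℝ) × (Fin (d + 1) → ℝ) =>
      rowMul (b.1.1 : Vec d) (M.companion b.2) :=
  measurable_rowMul (fun i j => (M.measurable_companion i j).comp measurable_snd)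
    (measurable_subtype_coe.comp (measurable_fst.comp measurable_fst))

theorem measurable_chainStep (M : Model Ω d) :
    Measurable fun b : (Sph d × ℝ) × (Fin (d + 1) → ℝ) => M.chainStep b.1 b.2 :=
  (measurable_dir (measurable_fst.comp measurable_fst) M.measurable_rowMul_companion).prodMk
    ((measurable_snd.comp measurable_fst).add
      (Real.measurable_log.comp M.measurable_rowMul_companion.norm))

theorem measurable_tiltDensity (M : Model Ω d) (lam : ℝ) {h : Sph d → ℝ} (hh : Measurable h) :
    Measurable fun b : (Sph d × ℝ) × (Fin (d + 1) → ℝ) => M.tiltDensity lam h b.1.1 b.2 :=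
  Measurable.ennreal_ofReal <| (hh.comp (measurable_fst.comp measurable_fst)).inv.mul <|
    (M.measurable_rowMul_companion.norm.pow_const lam).mul <|
      hh.comp (measurable_dir (measurable_fst.comp measurable_fst) M.measurable_rowMul_companion)

theorem measurable_tiltDensity_right (M : Model Ω d) (lam : ℝ) {h : Sph d → ℝ}
    (hh : Measurable h) (x : Sph d) : Measurable (M.tiltDensity lam h x) :=
  (M.measurable_tiltDensity lam hh).comp (measurable_prodMk_left (x := ((x, 0) : Sph d × ℝ)))

theorem measurable_chainStep_right (M : Model Ω d) (p : Sph d × ℝ) : Measurable (M.chainStep p) :=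
  M.measurable_chainStep.comp measurable_prodMk_left

theorem xs_zero (M : Model Ω d) (x : Sph d) (ω : Ω) : M.xs x 0 ω = x := by
  rw [xs, prodA, rowMul_one, dir_self]

theorem vs_zero (M : Model Ω d) (x : Sph d) (ω : Ω) : M.vs x 0 ω = 0 := by
  have hx : ‖(x : Vec d)‖ = 1 := mem_sphere_zero_iff_norm.1 x.2
  rw [vs, prodA, rowMul_one, hx, Real.log_one]

theorem tiltWeight_zero (M : Model Ω d) (lam : ℝ) {h : Sph d → ℝ} (hpos : ∀ x, 0 < h x)
    (x : Sph d) (ω : Ω) : M.tiltWeight lam h x 0 ω = 1 := by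
  have hx : ‖(x : Vec d)‖ = 1 := mem_sphere_zero_iff_norm.1 x.2
  rw [tiltWeight, xs_zero, prodA, rowMul_one, hx, Real.one_rpow, one_mul,
    inv_mul_cancel₀ (hpos x).ne', ENNReal.ofReal_one]

/-- This makes the placeholder direction and the value log 0 = 0 harmless: wherever they occur, the
weight is zero. -/
theorem tiltWeight_eq_zero (M : Model Ω d) {lam : ℝ} (hlam : 0 < lam) (h : Sph d → ℝ)
    (x : Sph d) {n : ℕ} {ω : Ω} (hz : rowMul (x : Vec d) (M.prodA 0 n ω) = 0) :
    M.tiltWeight lam h x n ω = 0 := by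
  rw [tiltWeight, hz, norm_zero, Real.zero_rpow hlam.ne', zero_mul, mul_zero, ENNReal.ofReal_zero]

theorem rowMul_prodA_succ (M : Model Ω d) (x : Sph d) (n : ℕ) (ω : Ω) :
    rowMul (x : Vec d) (M.prodA 0 (n + 1) ω) = ‖rowMul (x : Vec d) (M.prodA 0 n ω)‖ •
      rowMul (M.xs x n ω : Vec d) (M.companion (M.noise n ω).1) := by
  rw [prodA, rowMul_mul, ← rowMul_smul, xs, norm_smul_dir, zero_add]
  rfl

/-- The cocycle property of the weights: lengths multiply along the chain and the intermediate value
of h cancels. It is what makes the tilted process Markov. -/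
theorem tiltWeight_mul_tiltDensity (M : Model Ω d) {lam : ℝ} (hlam : 0 < lam) {h : Sph d → ℝ}
    (hpos : ∀ x, 0 < h x) (x : Sph d) (n : ℕ) (ω : Ω) :
    M.tiltWeight lam h x n ω * M.tiltDensity lam h (M.xs x n ω) (M.noise n ω).1 =
      M.tiltWeight lam h x (n + 1) ω := by
  by_cases hz : rowMul (x : Vec d) (M.prodA 0 n ω) = 0
  · rw [M.tiltWeight_eq_zero hlam h x hz, zero_mul, M.tiltWeight_eq_zero hlam h x]
    rw [rowMul_prodA_succ, hz, norm_zero, zero_smul]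
  by_cases hz' : rowMul (M.xs x n ω : Vec d) (M.companion (M.noise n ω).1) = 0
  · rw [M.tiltWeight_eq_zero hlam h x (n := n + 1) (by rw [rowMul_prodA_succ, hz', smul_zero]),
      tiltDensity, hz', norm_zero, Real.zero_rpow hlam.ne', zero_mul, mul_zero,
      ENNReal.ofReal_zero, mul_zero]
  have hdir : M.xs x (n + 1) ω = dir (M.xs x n ω)
      (rowMul (M.xs x n ω : Vec d) (M.companion (M.noise n ω).1)) := by
    conv_lhs => rw [xs]
    rw [rowMul_prodA_succ, dir_smul x (M.xs x n ω) (norm_pos_iff.2 hz) hz']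
  have hh : 0 < h (M.xs x n ω) := hpos _
  rw [tiltWeight, tiltWeight, tiltDensity, ← ENNReal.ofReal_mul (mul_nonneg
    (inv_nonneg.2 (hpos x).le) (mul_nonneg (Real.rpow_nonneg (norm_nonneg _) _) hh.le)), hdir,
    rowMul_prodA_succ, norm_smul, norm_norm, Real.mul_rpow (norm_nonneg _) (norm_nonneg _)]
  congr 1
  field_simp

theorem chainStep_chain (M : Model Ω d) (x : Sph d) (n : ℕ) {ω : Ω}
    (hz : rowMul (x : Vec d) (M.prodA 0 (n + 1) ω) ≠ 0) :
    M.chainStep (M.xs x n ω, M.vs x n ω) (M.noise n ω).1 =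
      (M.xs x (n + 1) ω, M.vs x (n + 1) ω) := by
  rw [rowMul_prodA_succ, smul_ne_zero_iff, norm_ne_zero_iff] at hz
  have hdir : M.xs x (n + 1) ω = dir (M.xs x n ω)
      (rowMul (M.xs x n ω : Vec d) (M.companion (M.noise n ω).1)) := by
    conv_lhs => rw [xs]
    rw [rowMul_prodA_succ, dir_smul x (M.xs x n ω) (norm_pos_iff.2 hz.1) hz.2]
  rw [chainStep, hdir, vs, vs, rowMul_prodA_succ, norm_smul, norm_norm,
    Real.log_mul (norm_ne_zero_iff.2 hz.1) (norm_ne_zero_iff.2 hz.2)]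

theorem measurable_xs_past (M : Model Ω d) (x : Sph d) {k n : ℕ} (hk : k ≤ n) :
    Measurable[M.past n] (M.xs x k) :=
  measurable_dir (m := M.past n) measurable_const (M.measurable_rowMul_prodA_past x hk)

theorem measurable_vs_past (M : Model Ω d) (x : Sph d) {k n : ℕ} (hk : k ≤ n) :
    Measurable[M.past n] (M.vs x k) :=
  (Real.measurable_log.comp measurable_norm).comp (M.measurable_rowMul_prodA_past x hk)

theorem measurable_chain_past (M : Model Ω d) (x : Sph d) (n : ℕ) :
    Measurable[M.past n] (M.chain x n) :=
  @measurable_pi_lambda _ _ _ (M.past n) _ _ fun k =>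
    (M.measurable_xs_past x (Finset.mem_Iic.1 k.2)).prodMk
      (M.measurable_vs_past x (Finset.mem_Iic.1 k.2))

theorem measurable_tiltWeight_past (M : Model Ω d) (lam : ℝ) {h : Sph d → ℝ} (hh : Measurable h)
    (x : Sph d) (n : ℕ) : Measurable[M.past n] (M.tiltWeight lam h x n) := by
  have hf : Measurable fun b : Vec d × Sph d =>
      ENNReal.ofReal ((h x)⁻¹ * (‖b.1‖ ^ lam * h b.2)) :=
    Measurable.ennreal_ofReal <| Measurable.const_mul
      ((measurable_fst.norm.pow_const lam).mul (hh.comp measurable_snd)) _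
  have hp : Measurable[M.past n] fun ω => (rowMul (x : Vec d) (M.prodA 0 n ω), M.xs x n ω) :=
    (M.measurable_rowMul_prodA_past x le_rfl).prodMk (M.measurable_xs_past x le_rfl)
  have hc := hf.comp hp
  exact hc

/-- Extension of a trajectory by one point. -/
def snocPath {β : Type*} (n : ℕ) (b : (Finset.Iic n → β) × β) (i : Finset.Iic (n + 1)) : β :=
  if hi : (i : ℕ) ≤ n then b.1 ⟨i, Finset.mem_Iic.2 hi⟩ else b.2

theorem measurable_snocPath {β : Type*} [MeasurableSpace β] (n : ℕ) :
    Measurable (snocPath (β := β) n) := by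
  refine measurable_pi_lambda _ fun i => ?_
  unfold snocPath
  split_ifs with hi
  · exact (measurable_pi_apply _).comp measurable_fst
  · exact measurable_snd

theorem snocPath_restrict {β : Type*} (n : ℕ) (p : ℕ → β) :
    snocPath n (fun i => p i, p (n + 1)) = fun i : Finset.Iic (n + 1) => p i := by
  ext1 i
  unfold snocPath
  split_ifs with hi
  · rfl
  · have h1 := Finset.mem_Iic.1 i.2
    rw [show (i : ℕ) = n + 1 by omega]

variable [MeasurableSpace Ω]

/-- The law of the coefficient noise. -/
def coefLaw (M : Model Ω d) (P : Measure Ω) : Measure (Fin (d + 1) → ℝ) :=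
  P.map fun ω => (M.noise 0 ω).1

/-- The transition law of the tilted chain. -/
def tiltStep (M : Model Ω d) (P : Measure Ω) (lam : ℝ) (h : Sph d → ℝ) (p : Sph d × ℝ) :
    Measure (Sph d × ℝ) :=
  ((M.coefLaw P).withDensity (M.tiltDensity lam h p.1)).map (M.chainStep p)

theorem lintegral_tiltStep (M : Model Ω d) (P : Measure Ω) (lam : ℝ) {h : Sph d → ℝ}
    (hh : Measurable h) (p : Sph d × ℝ) {f : Sph d × ℝ → ℝ≥0∞} (hf : Measurable f) :
    ∫⁻ y, f y ∂(M.tiltStep P lam h p) =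
      ∫⁻ e, M.tiltDensity lam h p.1 e * f (M.chainStep p e) ∂(M.coefLaw P) := by
  rw [tiltStep, lintegral_map hf (M.measurable_chainStep_right p),
    lintegral_withDensity_eq_lintegral_mul (M.coefLaw P)
      (M.measurable_tiltDensity_right lam hh p.1)
      (g := fun e => f (M.chainStep p e)) (hf.comp (M.measurable_chainStep_right p))]
  rfl

theorem measurable_tiltStep (M : Model Ω d) (P : Measure Ω) [IsProbabilityMeasure P] (lam : ℝ)
    {h : Sph d → ℝ} (hh : Measurable h) : Measurable (M.tiltStep P lam h) := by
  have : SFinite (M.coefLaw P) := by unfold coefLaw; infer_instance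
  refine Measure.measurable_of_measurable_coe _ fun s hs => ?_
  have h1 : ∀ p, M.tiltStep P lam h p s = ∫⁻ e, M.tiltDensity lam h p.1 e *
      s.indicator 1 (M.chainStep p e) ∂(M.coefLaw P) := fun p => by
    rw [← lintegral_tiltStep M P lam hh p (measurable_one.indicator hs), lintegral_indicator_one hs]
  simp only [h1]
  exact ((M.measurable_tiltDensity lam hh).mul
    ((measurable_one.indicator hs).comp M.measurable_chainStep)).lintegral_prod_right'

/-- The transition kernels of the tilted chain, as functions of the trajectory. -/
def tiltKernel (M : Model Ω d) (P : Measure Ω) [IsProbabilityMeasure P] (lam : ℝ)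
    {h : Sph d → ℝ} (hh : Measurable h) (n : ℕ) :
    Kernel (Finset.Iic n → Sph d × ℝ) (Sph d × ℝ) where
  toFun q := M.tiltStep P lam h (q ⟨n, Finset.mem_Iic.2 le_rfl⟩)
  measurable' := (M.measurable_tiltStep P lam hh).comp (measurable_pi_apply _)

variable {M : Model Ω d} {P : Measure Ω}

theorem Standing.measurable_coef (hM : M.Standing P) (n : ℕ) :
    Measurable fun ω => (M.noise n ω).1 :=
  measurable_fst.comp (hM.measurable_noise n)

theorem Standing.map_coef (hM : M.Standing P) (n : ℕ) :
    P.map (fun ω => (M.noise n ω).1) = M.coefLaw P :=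
  (hM.ident_η n).map_eq

/-- This is the eigenfunction equation divided by h(x). -/
theorem lintegral_tiltDensity (hM : M.Standing P) {lam : ℝ} {h : Sph d → ℝ}
    (hh : Measurable h) (hpos : ∀ x, 0 < h x) (heig : ∀ x, M.Q P lam h x = h x) (x : Sph d) :
    ∫⁻ e, M.tiltDensity lam h x e ∂(M.coefLaw P) = 1 := by
  rw [coefLaw, lintegral_map (M.measurable_tiltDensity_right lam hh x) (hM.measurable_coef 0)]
  have hint : Integrable (fun ω => ‖rowMul (x : Vec d) (M.A 0 ω)‖ ^ lam *
      h (dir x (rowMul x (M.A 0 ω)))) P := by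
    -- Without integrability the Bochner integral would be 0, contradicting h(x) > 0.
    by_contra hcon
    have h1 := heig x
    rw [Q, integral_undef hcon] at h1
    exact (hpos x).ne h1
  have h2 : ∫ ω, (h x)⁻¹ * (‖rowMul (x : Vec d) (M.A 0 ω)‖ ^ lam *
      h (dir x (rowMul x (M.A 0 ω)))) ∂P = 1 := by
    rw [integral_const_mul]
    have h1 := heig x
    rw [Q] at h1
    rw [h1, inv_mul_cancel₀ (hpos x).ne']
  have h3 := ofReal_integral_eq_lintegral_ofReal (hint.const_mul (h x)⁻¹)
    (ae_of_all _ fun ω => mul_nonneg (inv_nonneg.2 (hpos x).le)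
      (mul_nonneg (Real.rpow_nonneg (norm_nonneg _) _) (hpos _).le))
  rw [h2, ENNReal.ofReal_one] at h3
  exact h3.symm

theorem isMarkovKernel_tiltKernel [IsProbabilityMeasure P] (hM : M.Standing P) {lam : ℝ}
    {h : Sph d → ℝ} (hh : Measurable h) (hpos : ∀ x, 0 < h x)
    (heig : ∀ x, M.Q P lam h x = h x) (n : ℕ) :
    IsMarkovKernel (M.tiltKernel P lam hh n) := by
  refine ⟨fun q => ⟨?_⟩⟩
  have h1 := M.lintegral_tiltStep P lam hh (q ⟨n, Finset.mem_Iic.2 le_rfl⟩)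
    (f := fun _ => 1) measurable_const
  simp only [mul_one, lintegral_const, one_mul] at h1
  exact h1.trans (lintegral_tiltDensity hM hh hpos heig _)

/-- The tilted law exists. -/
theorem exists_isTiltedLaw [IsProbabilityMeasure P] (hM : M.Standing P) {lam : ℝ}
    (hlam : 0 < lam) {h : Sph d → ℝ} (hh : Measurable h) (hpos : ∀ x, 0 < h x)
    (heig : ∀ x, M.Q P lam h x = h x) (x : Sph d) :
    ∃ μ, M.IsTiltedLaw P lam h x μ := by
  have hmk := isMarkovKernel_tiltKernel hM hh hpos heig
  set κ := M.tiltKernel P lam hh with hκ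
  set x₀ : Finset.Iic 0 → Sph d × ℝ := fun _ => (x, 0) with hx₀
  -- The Ionescu-Tulcea measure started from the one-point trajectory (x, 0). Its finite-dimensional
  -- laws are identified below by induction on n.
  set μ : Measure (ℕ → Sph d × ℝ) :=
    Kernel.traj (X := fun _ => Sph d × ℝ) κ 0 x₀ with hμ
  refine ⟨μ, inferInstance, fun n => ?_⟩
  change ∀ F : (Finset.Iic n → Sph d × ℝ) → ℝ≥0∞, Measurable F →
    ∫⁻ p, F (fun k => p k) ∂μ = ∫⁻ ω, M.tiltWeight lam h x n ω * F (M.chain x n ω) ∂P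
  have hres : ∀ n : ℕ, Measurable fun (p : ℕ → Sph d × ℝ) (k : Finset.Iic n) => p k := fun n => by
    fun_prop
  have hmap : ∀ n : ℕ, μ.map (fun p (k : Finset.Iic n) => p k) =
      Kernel.partialTraj (X := fun _ => Sph d × ℝ) κ 0 n x₀ := fun n =>
    Kernel.traj_map_frestrictLe_apply (X := fun _ => Sph d × ℝ) (κ := κ) 0 n x₀
  induction n with
  | zero =>
    intro F hF
    have h1 : ∫⁻ p, F (fun k => p k) ∂μ = F x₀ := by
      rw [← lintegral_map hF (hres 0), hmap, Kernel.partialTraj_self, Kernel.id_apply,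
        lintegral_dirac' _ hF]
    have h2 : ∀ ω, M.chain x 0 ω = x₀ := fun ω => by
      ext1 k
      have hk : (k : ℕ) = 0 := by have := Finset.mem_Iic.1 k.2; omega
      rw [chain, hk, xs_zero, vs_zero]
    simp [h1, h2, tiltWeight_zero M lam hpos]
  | succ n ih =>
    intro F hF
    set G : (Finset.Iic n → Sph d × ℝ) × (Sph d × ℝ) → ℝ≥0∞ := fun b => F (snocPath n b) with hG
    have hGm : Measurable G := hF.comp (measurable_snocPath n)
    have hlaw : μ.map (fun p => ((fun k => p k : Finset.Iic n → Sph d × ℝ), p (n + 1))) =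
        (Kernel.partialTraj (X := fun _ => Sph d × ℝ) κ 0 n x₀) ⊗ₘ (κ n) :=
      (Kernel.partialTraj_compProd_eq_map_traj (X := fun _ => Sph d × ℝ) (κ := κ)
        (Nat.zero_le n)).symm
    have hstep : ∫⁻ p, F (fun k => p k) ∂μ =
        ∫⁻ p, ∫⁻ y, G ((fun k => p k : Finset.Iic n → Sph d × ℝ), y)
          ∂(κ n (fun k => p k)) ∂μ := by
      have h1 : ∀ p : ℕ → Sph d × ℝ,
          F (fun k => p k) = G ((fun k => p k : Finset.Iic n → Sph d × ℝ), p (n + 1)) :=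
        fun p => by rw [hG]; simp only [snocPath_restrict]
      simp only [h1]
      rw [← lintegral_map (μ := μ) hGm ((hres n).prodMk (measurable_pi_apply (n + 1))), hlaw,
        Measure.lintegral_compProd hGm, ← hmap, lintegral_map _ (hres n)]
      exact hGm.lintegral_kernel_prod_right'
    have hinner : ∀ q : Finset.Iic n → Sph d × ℝ, ∫⁻ y, G (q, y) ∂(κ n q) =
        ∫⁻ e, M.tiltDensity lam h (q ⟨n, Finset.mem_Iic.2 le_rfl⟩).1 e *
          G (q, M.chainStep (q ⟨n, Finset.mem_Iic.2 le_rfl⟩) e) ∂(M.coefLaw P) := fun q =>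
      M.lintegral_tiltStep P lam hh _ (hGm.comp measurable_prodMk_left)
    rw [hstep, ih (fun q => ∫⁻ y, G (q, y) ∂(κ n q)) hGm.lintegral_kernel_prod_right']
    simp only [hinner]
    -- The weight and the chain up to time n depend on the past, the noise at time n on the future;
    -- φ joins them so that independence replaces the integral over the coefficient law by the
    -- actual noise.
    set φ : (ℝ≥0∞ × (Finset.Iic n → Sph d × ℝ)) × (Fin (d + 1) → ℝ) → ℝ≥0∞ := fun b =>
      b.1.1 * (M.tiltDensity lam h (b.1.2 ⟨n, Finset.mem_Iic.2 le_rfl⟩).1 b.2 *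
        G (b.1.2, M.chainStep (b.1.2 ⟨n, Finset.mem_Iic.2 le_rfl⟩) b.2)) with hφ
    have hev : Measurable fun b : (ℝ≥0∞ × (Finset.Iic n → Sph d × ℝ)) × (Fin (d + 1) → ℝ) =>
        (b.1.2 ⟨n, Finset.mem_Iic.2 le_rfl⟩, b.2) :=
      ((measurable_pi_apply _).comp (measurable_snd.comp measurable_fst)).prodMk measurable_snd
    have hφm : Measurable φ :=
      (measurable_fst.comp measurable_fst).mul
        (((M.measurable_tiltDensity lam hh).comp hev).mul
          (hGm.comp ((measurable_snd.comp measurable_fst).prodMk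
            (M.measurable_chainStep.comp hev))))
    have hUp : Measurable[M.past n] fun ω => (M.tiltWeight lam h x n ω, M.chain x n ω) :=
      (M.measurable_tiltWeight_past lam hh x n).prodMk (M.measurable_chain_past x n)
    have hV : Measurable[M.future n] fun ω => (M.noise n ω).1 :=
      measurable_fst.comp (M.measurable_noise_future le_rfl)
    have hind := lintegral_comp_prodMk_of_indepFun (hM.indepFun_past_future hUp hV)
      (hUp.mono (hM.past_le n) le_rfl) (hM.measurable_coef n) hφm
    rw [hM.map_coef n] at hind
    have hpull : ∀ ω, M.tiltWeight lam h x n ω *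
        ∫⁻ e, M.tiltDensity lam h (M.chain x n ω ⟨n, Finset.mem_Iic.2 le_rfl⟩).1 e *
          G (M.chain x n ω, M.chainStep (M.chain x n ω ⟨n, Finset.mem_Iic.2 le_rfl⟩) e)
          ∂(M.coefLaw P) =
        ∫⁻ e, φ ((M.tiltWeight lam h x n ω, M.chain x n ω), e) ∂(M.coefLaw P) := fun ω =>
      (lintegral_const_mul' _ _ ENNReal.ofReal_ne_top).symm
    simp only [hpull]
    rw [← hind]
    refine lintegral_congr fun ω => ?_
    simp only [hφ, chain]
    rw [← mul_assoc, tiltWeight_mul_tiltDensity M hlam hpos]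
    -- If the product vanishes, the chain step need not match the actual chain, but both sides carry
    -- weight zero.
    by_cases hz : rowMul (x : Vec d) (M.prodA 0 (n + 1) ω) = 0
    · rw [M.tiltWeight_eq_zero hlam h x hz, zero_mul, zero_mul]
    · rw [chainStep_chain M x n hz, hG]
      congr 1
      exact congrArg F <| snocPath_restrict n fun k => (M.xs x k ω, M.vs x k ω)

end Model

/-! ### Weighted and smoothed tails -/

theorem measurableSet_lt_inner {d : ℕ} (x : Vec d) (u : ℝ) :
    MeasurableSet {y : Vec d | u < inner ℝ x y} :=
  measurableSet_lt measurable_const (measurable_const.inner measurable_id')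

section WeightedTail

variable {Ω : Type*} [MeasurableSpace Ω]

/-- The weighted tail `∫_0^T u ^ lam P(X > u) du`. -/
def weightedTail (P : Measure Ω) (lam : ℝ) (X : Ω → ℝ) (T : ℝ) : ℝ≥0∞ :=
  ∫⁻ u in Set.Ioc 0 T, ENNReal.ofReal (u ^ lam) * P {ω | u < X ω}

theorem weightedTail_lt_top (P : Measure Ω) [IsProbabilityMeasure P] {lam : ℝ} (hlam : 0 ≤ lam)
    (X : Ω → ℝ) (T : ℝ) : weightedTail P lam X T < ∞ := by
  calc weightedTail P lam X T ≤ ∫⁻ _u in Set.Ioc 0 T, ENNReal.ofReal (T ^ lam) := by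
        refine setLIntegral_mono measurable_const fun u hu => ?_
        refine (mul_le_of_le_one_right' prob_le_one).trans (ENNReal.ofReal_le_ofReal ?_)
        exact Real.rpow_le_rpow hu.1.le hu.2 hlam
    _ < ∞ := by
        rw [setLIntegral_const]
        exact ENNReal.mul_lt_top ENNReal.ofReal_lt_top (by simp)

/-- Monotonicity in u suffices, so X itself need not be measurable. -/
theorem measurable_measure_lt (P : Measure Ω) (X : Ω → ℝ) : Measurable fun u => P {ω | u < X ω} :=
  Antitone.measurable fun _ _ huv => measure_mono fun _ hω => lt_of_le_of_lt huv hω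

theorem aestronglyMeasurable_weightedTail (P : Measure Ω) (lam : ℝ) (X : Ω → ℝ) (μ : Measure ℝ) :
    AEStronglyMeasurable (fun u => u ^ lam * P.real {ω | u < X ω}) μ :=
  ((measurable_id.pow_const lam).mul
    (measurable_measure_lt P X).ennreal_toReal).aestronglyMeasurable

theorem setLIntegral_ofReal_rpow_mul (P : Measure Ω) [IsProbabilityMeasure P] (lam : ℝ)
    (X : Ω → ℝ) (T : ℝ) :
    ∫⁻ u in Set.Ioc 0 T, ENNReal.ofReal (u ^ lam * P.real {ω | u < X ω}) =
      weightedTail P lam X T := by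
  refine setLIntegral_congr_fun measurableSet_Ioc fun u hu => ?_
  rw [ENNReal.ofReal_mul (Real.rpow_nonneg hu.1.le _), ofReal_measureReal]

theorem intervalIntegrable_rpow_mul_measureReal (P : Measure Ω) [IsProbabilityMeasure P]
    {lam : ℝ} (hlam : 0 ≤ lam) (X : Ω → ℝ) {T : ℝ} (hT : 0 ≤ T) :
    IntervalIntegrable (fun u => u ^ lam * P.real {ω | u < X ω}) volume 0 T := by
  rw [intervalIntegrable_iff_integrableOn_Ioc_of_le hT]
  refine ⟨aestronglyMeasurable_weightedTail P lam X _, ?_⟩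
  rw [hasFiniteIntegral_iff_ofReal, setLIntegral_ofReal_rpow_mul]
  · exact weightedTail_lt_top P hlam X T
  · filter_upwards [self_mem_ae_restrict measurableSet_Ioc] with u hu
    exact mul_nonneg (Real.rpow_nonneg hu.1.le _) measureReal_nonneg

theorem integral_rpow_mul_measureReal (P : Measure Ω) [IsProbabilityMeasure P] (lam : ℝ)
    (X : Ω → ℝ) {T : ℝ} (hT : 0 ≤ T) :
    ∫ u in (0 : ℝ)..T, u ^ lam * P.real {ω | u < X ω} = (weightedTail P lam X T).toReal := by
  rw [intervalIntegral.integral_of_le hT, integral_eq_lintegral_of_nonneg_ae _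
    (aestronglyMeasurable_weightedTail P lam X _), setLIntegral_ofReal_rpow_mul]
  filter_upwards [self_mem_ae_restrict measurableSet_Ioc] with u hu
  exact mul_nonneg (Real.rpow_nonneg hu.1.le _) measureReal_nonneg

/-- Markov's inequality for weighted tails. -/
theorem weightedTail_le (P : Measure Ω) (lam : ℝ) {X : Ω → ℝ} (hX : Measurable X) (T : ℝ) :
    weightedTail P lam X T ≤
      (∫⁻ u in Set.Ioc 0 T, ENNReal.ofReal (u ^ (lam - 1))) * ∫⁻ ω, ‖X ω‖ₑ ∂P := by
  rw [← lintegral_mul_const _ (measurable_id'.pow_const (lam - 1)).ennreal_ofReal]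
  refine setLIntegral_mono
    ((measurable_id.pow_const (lam - 1)).ennreal_ofReal.mul_const _) fun u hu => ?_
  have h1 : P {ω | u < X ω} ≤ (∫⁻ ω, ‖X ω‖ₑ ∂P) / ENNReal.ofReal u := by
    refine le_trans (measure_mono fun ω (hω : u < X ω) => ?_)
      (meas_ge_le_lintegral_div hX.enorm.aemeasurable (by simpa using hu.1)
        ENNReal.ofReal_ne_top)
    change ENNReal.ofReal u ≤ ‖X ω‖ₑ
    rw [← ofReal_norm]
    exact ENNReal.ofReal_le_ofReal (hω.le.trans (le_abs_self _))
  calc ENNReal.ofReal (u ^ lam) * P {ω | u < X ω}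
      ≤ ENNReal.ofReal (u ^ lam) * ((∫⁻ ω, ‖X ω‖ₑ ∂P) / ENNReal.ofReal u) := by gcongr
    _ = ENNReal.ofReal (u ^ (lam - 1)) * ∫⁻ ω, ‖X ω‖ₑ ∂P := by
        rw [Real.rpow_sub_one hu.1.ne', ENNReal.ofReal_div_of_pos hu.1, div_eq_mul_inv,
          div_eq_mul_inv, mul_left_comm, mul_comm, mul_assoc, mul_comm]

theorem setLIntegral_rpow_sub_one_lt_top {lam : ℝ} (hlam : 0 < lam) {T : ℝ} (hT : 0 ≤ T) :
    ∫⁻ u in Set.Ioc 0 T, ENNReal.ofReal (u ^ (lam - 1)) < ∞ := by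
  have h := intervalIntegral.intervalIntegrable_rpow' (a := 0) (b := T) (r := lam - 1)
    (by linarith)
  rw [intervalIntegrable_iff_integrableOn_Ioc_of_le hT] at h
  exact h.lintegral_lt_top

/-- Averaging the weighted tail over one of two independent vectors. -/
theorem lintegral_weightedTail_inner {d : ℕ} {P : Measure Ω} [IsProbabilityMeasure P]
    {Z V : Ω → Vec d} (hZV : IndepFun Z V P) (hZ : Measurable Z) (hV : Measurable V)
    (lam T : ℝ) :
    ∫⁻ ω, weightedTail (P.map V) lam (fun y => inner ℝ (Z ω) y) T ∂P =
      weightedTail P lam (fun ω => inner ℝ (Z ω) (V ω)) T := by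
  have : IsProbabilityMeasure (P.map V) := Measure.isProbabilityMeasure_map hV.aemeasurable
  have hset : MeasurableSet {b : (Ω × ℝ) × Vec d | b.1.2 < inner ℝ (Z b.1.1) b.2} :=
    measurableSet_lt (measurable_snd.comp measurable_fst)
      ((hZ.comp (measurable_fst.comp measurable_fst)).inner measurable_snd)
  have hm : Measurable fun b : Ω × ℝ => P.map V {y | b.2 < inner ℝ (Z b.1) y} :=
    measurable_measure_prodMk_left hset
  simp only [weightedTail]
  -- By Tonelli it is enough to compare the tails at a fixed level u, where independence applies.
  rw [lintegral_lintegral_swap]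
  · refine lintegral_congr fun u => ?_
    rw [lintegral_const_mul' _ _ ENNReal.ofReal_ne_top]
    congr 1
    have hs : MeasurableSet {b : Vec d × Vec d | u < inner ℝ b.1 b.2} :=
      measurableSet_lt measurable_const (measurable_fst.inner measurable_snd)
    have h1 := lintegral_comp_prodMk_of_indepFun hZV hZ hV
      ((measurable_one (α := ℝ≥0∞)).indicator hs)
    have h2 : ∫⁻ ω, {b : Vec d × Vec d | u < inner ℝ b.1 b.2}.indicator 1 (Z ω, V ω) ∂P =
        P {ω | u < inner ℝ (Z ω) (V ω)} :=
      lintegral_indicator_one ((hZ.prodMk hV) hs)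
    rw [h2] at h1
    rw [h1]
    exact lintegral_congr fun ω => (lintegral_indicator_one (measurable_prodMk_left hs)).symm
  · exact (((measurable_id.pow_const lam).ennreal_ofReal.comp measurable_snd).mul
      hm).aemeasurable

end WeightedTail

/-- The normalized smoothed tail of the linear functional `x'` under the law `ν`. -/
def smoothTail {d : ℕ} (ν : Measure (Vec d)) (lam : ℝ) (h : Sph d → ℝ) (p : Sph d × ℝ) : ℝ :=
  (h p.1 * Real.exp p.2)⁻¹ *
    ∫ u in (0 : ℝ)..Real.exp p.2, u ^ lam * ν.real {y | u < inner ℝ (p.1 : Vec d) y}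

/-- Substitution u ↦ cu: the power weight gives c ^ lam and the differential one more factor c. -/
theorem integral_rpow_mul_measureReal_smul {d : ℕ} (ν : Measure (Vec d)) {lam : ℝ} {c : ℝ} (hc : 0 < c) (z : Vec d) {T : ℝ}
    (hT : 0 ≤ T) :
    ∫ u in (0 : ℝ)..T, u ^ lam * ν.real {y | u < inner ℝ (c • z) y} =
      c ^ (lam + 1) * ∫ u in (0 : ℝ)..T / c, u ^ lam * ν.real {y | u < inner ℝ z y} := by
  have h1 := intervalIntegral.integral_comp_mul_left
    (f := fun u : ℝ => u ^ lam * ν.real {y | u < inner ℝ (c • z) y}) (a := 0) (b := T / c) (c := c) hc.ne'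
  rw [mul_zero, mul_div_cancel₀ _ hc.ne', smul_eq_mul, eq_inv_mul_iff_mul_eq₀ hc.ne'] at h1
  rw [← h1, Real.rpow_add_one hc.ne', mul_comm (c ^ lam) c, mul_assoc,
    ← intervalIntegral.integral_const_mul (c ^ lam)]
  congr 1
  refine intervalIntegral.integral_congr fun u hu => ?_
  rw [Set.uIcc_of_le (div_nonneg hT hc.le)] at hu
  have h2 : {y : Vec d | c * u < inner ℝ (c • z) y} = {y | u < inner ℝ z y} := by
    ext y
    simp only [Set.mem_ofPred_eq, real_inner_smul_left, mul_lt_mul_iff_right₀ hc]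
  simp only [h2, Real.mul_rpow hc.le hu.1, mul_assoc]

section SmoothTail

variable {d : ℕ} (ν : Measure (Vec d)) [IsProbabilityMeasure ν] {lam : ℝ} {h : Sph d → ℝ}

theorem smoothTail_nonneg (hpos : ∀ x, 0 < h x) (p : Sph d × ℝ) : 0 ≤ smoothTail ν lam h p := by
  rw [smoothTail, integral_rpow_mul_measureReal ν lam _ (Real.exp_pos _).le]
  exact mul_nonneg (inv_nonneg.2 (mul_nonneg (hpos _).le (Real.exp_pos _).le))
    ENNReal.toReal_nonneg

theorem measurable_smoothTail (hh : Measurable h) : Measurable (smoothTail ν lam h) := by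
  have hcoe : Measurable fun b : ((Sph d × ℝ) × ℝ) × Vec d => (b.1.1.1 : Vec d) :=
    measurable_subtype_coe.comp (measurable_fst.comp (measurable_fst.comp measurable_fst))
  have hset : MeasurableSet {b : ((Sph d × ℝ) × ℝ) × Vec d |
      b.1.2 < inner ℝ (b.1.1.1 : Vec d) b.2} :=
    measurableSet_lt (measurable_snd.comp measurable_fst) (hcoe.inner measurable_snd)
  have hm : Measurable fun b : (Sph d × ℝ) × ℝ => ν {y | b.2 < inner ℝ (b.1.1 : Vec d) y} :=
    measurable_measure_prodMk_left hset
  have hs : MeasurableSet {b : (Sph d × ℝ) × ℝ | b.2 ∈ Set.Ioc 0 (Real.exp b.1.2)} :=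
    (measurableSet_lt measurable_const measurable_snd).inter
      (measurableSet_le measurable_snd
        (Real.measurable_exp.comp (measurable_snd.comp measurable_fst)))
  have hI : Measurable fun p : Sph d × ℝ =>
      weightedTail ν lam (fun y => inner ℝ (p.1 : Vec d) y) (Real.exp p.2) := by
    have h1 : ∀ p : Sph d × ℝ,
        weightedTail ν lam (fun y => inner ℝ (p.1 : Vec d) y) (Real.exp p.2) =
          ∫⁻ u, {b : (Sph d × ℝ) × ℝ | b.2 ∈ Set.Ioc 0 (Real.exp b.1.2)}.indicator
            (fun b => ENNReal.ofReal (b.2 ^ lam) * ν {y | b.2 < inner ℝ (b.1.1 : Vec d) y})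
            (p, u) := fun p => by
      rw [weightedTail, ← lintegral_indicator measurableSet_Ioc]
      rfl
    simp only [h1]
    exact ((((measurable_id.pow_const lam).ennreal_ofReal.comp measurable_snd).mul
      hm).indicator hs).lintegral_prod_right'
  have h2 : smoothTail ν lam h = fun p : Sph d × ℝ => (h p.1 * Real.exp p.2)⁻¹ *
      (weightedTail ν lam (fun y => inner ℝ (p.1 : Vec d) y) (Real.exp p.2)).toReal := by
    ext p
    rw [smoothTail, integral_rpow_mul_measureReal ν lam _ (Real.exp_pos _).le]
  rw [h2]
  exact ((hh.comp measurable_fst).mul (Real.measurable_exp.comp measurable_snd)).inv.mul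
    hI.ennreal_toReal

/-- The pointwise cancellation behind the tilt: with c the length and y the direction of the row
product, the weight turns the smoothed tail at the moved point into an unnormalized tail at c • y.
-/
theorem weight_mul_smoothTail (hlam : 0 < lam) (hpos : ∀ x, 0 < h x) (x y : Sph d) {c : ℝ}
    (hc : 0 ≤ c) (t : ℝ) :
    (h x)⁻¹ * (c ^ lam * h y) * smoothTail ν lam h (y, t - Real.log c) =
      (h x * Real.exp t)⁻¹ *
        (weightedTail ν lam (fun v => inner ℝ (c • (y : Vec d)) v) (Real.exp t)).toReal := by
  rw [← integral_rpow_mul_measureReal ν lam _ (Real.exp_pos _).le]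
  have hy := hpos y
  have hx := hpos x
  -- For c = 0 both sides vanish: 0 ^ lam = 0 on the left, and the zero functional never exceeds u >
  -- 0 on the right.
  rcases hc.eq_or_lt with rfl | hc
  · rw [Real.zero_rpow hlam.ne', intervalIntegral.integral_of_le (Real.exp_pos t).le,
      setIntegral_congr_fun (g := fun _ => 0) measurableSet_Ioc fun u hu => ?_]
    · simp
    · simp [not_lt.2 hu.1.le]
  · rw [integral_rpow_mul_measureReal_smul ν hc _ (Real.exp_pos t).le, smoothTail]
    simp only [Real.exp_sub, Real.exp_log hc, Real.rpow_add_one hc.ne']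
    field_simp

end SmoothTail

/-! ### Means under the tilted law and telescoping -/

namespace Model

theorem measurable_A_mul_Y_future {Ω : Type*} {d : ℕ} (M : Model Ω d) (n : ℕ) :
    Measurable[M.future n] fun ω => colMul (M.A n ω) (M.Y (n + 1) ω) :=
  measurable_colMul (M.measurable_A_future le_rfl) (M.measurable_Y_future (Nat.le_succ n))

variable {Ω : Type*} {d : ℕ} [MeasurableSpace Ω] {M : Model Ω d} {P : Measure Ω}

/-- The mean of a smoothed tail under the tilted law. -/
theorem IsTiltedLaw.integral_smoothTail [IsProbabilityMeasure P] (hM : M.Standing P) {lam : ℝ}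
    (hlam : 0 < lam) {h : Sph d → ℝ} (hh : Measurable h) (hpos : ∀ x, 0 < h x) {x : Sph d}
    {μ : Measure (ℕ → Sph d × ℝ)} (hμ : M.IsTiltedLaw P lam h x μ) (n : ℕ) (t : ℝ)
    {V : Ω → Vec d} (hV : Measurable[M.future n] V) :
    Integrable (fun p => smoothTail (P.map V) lam h ((p n).1, t - (p n).2)) μ ∧
      ∫ p, smoothTail (P.map V) lam h ((p n).1, t - (p n).2) ∂μ =
        (h x * Real.exp t)⁻¹ * (weightedTail P lam
          (fun ω => inner ℝ (rowMul (x : Vec d) (M.prodA 0 n ω)) (V ω)) (Real.exp t)).toReal := by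
  have hV' : Measurable V := hV.mono (hM.future_le n) le_rfl
  have : IsProbabilityMeasure (P.map V) := Measure.isProbabilityMeasure_map hV'.aemeasurable
  set Z : Ω → Vec d := fun ω => rowMul (x : Vec d) (M.prodA 0 n ω) with hZ
  have hZp : Measurable[M.past n] Z := M.measurable_rowMul_prodA_past x le_rfl
  have hZm : Measurable Z := hZp.mono (hM.past_le n) le_rfl
  have hshift : Measurable fun b : Sph d × ℝ => (b.1, t - b.2) :=
    measurable_fst.prodMk (measurable_snd.const_sub t)
  have hsm : Measurable fun b : Sph d × ℝ => smoothTail (P.map V) lam h (b.1, t - b.2) :=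
    (measurable_smoothTail (P.map V) hh).comp hshift
  have hc0 : 0 ≤ (h x * Real.exp t)⁻¹ :=
    inv_nonneg.2 (mul_nonneg (hpos x).le (Real.exp_pos t).le)
  have hfin := weightedTail_lt_top P hlam.le (fun ω => inner ℝ (Z ω) (V ω)) (Real.exp t)
  have key : ∫⁻ p, ENNReal.ofReal (smoothTail (P.map V) lam h ((p n).1, t - (p n).2)) ∂μ =
      ENNReal.ofReal ((h x * Real.exp t)⁻¹ *
        (weightedTail P lam (fun ω => inner ℝ (Z ω) (V ω)) (Real.exp t)).toReal) := by
    rw [ENNReal.ofReal_mul hc0, ENNReal.ofReal_toReal hfin.ne,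
      ← lintegral_weightedTail_inner (hM.indepFun_past_future hZp hV) hZm hV',
      ← lintegral_const_mul' _ _ ENNReal.ofReal_ne_top]
    -- The defining property of the tilted law, applied to a function of the last point of the
    -- trajectory only.
    refine (hμ.fdd n (fun q => ENNReal.ofReal (smoothTail (P.map V) lam h
      ((q ⟨n, Finset.mem_Iic.2 le_rfl⟩).1, t - (q ⟨n, Finset.mem_Iic.2 le_rfl⟩).2)))
      (hsm.comp (measurable_pi_apply _)).ennreal_ofReal).trans ?_
    refine lintegral_congr fun ω => ?_
    have hw := weight_mul_smoothTail (P.map V) hlam hpos x (M.xs x n ω)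
      (norm_nonneg (rowMul (x : Vec d) (M.prodA 0 n ω))) t
    have hz : ‖rowMul (x : Vec d) (M.prodA 0 n ω)‖ • (M.xs x n ω : Vec d) = Z ω :=
      norm_smul_dir x _
    rw [hz] at hw
    change _ * ENNReal.ofReal (smoothTail (P.map V) lam h
      (M.xs x n ω, t - Real.log ‖rowMul (x : Vec d) (M.prodA 0 n ω)‖)) = _
    rw [← ENNReal.ofReal_mul (mul_nonneg (inv_nonneg.2 (hpos x).le)
      (mul_nonneg (Real.rpow_nonneg (norm_nonneg _) _) (hpos _).le)), hw,
      ENNReal.ofReal_mul hc0, ENNReal.ofReal_toReal (weightedTail_lt_top _ hlam.le _ _).ne]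
  have hmeas : Measurable fun p : ℕ → Sph d × ℝ =>
      smoothTail (P.map V) lam h ((p n).1, t - (p n).2) := hsm.comp (measurable_pi_apply n)
  have hnn : ∀ p : ℕ → Sph d × ℝ,
      0 ≤ smoothTail (P.map V) lam h ((p n).1, t - (p n).2) := fun p =>
    smoothTail_nonneg _ hpos _
  refine ⟨⟨hmeas.aestronglyMeasurable, ?_⟩, ?_⟩
  · rw [hasFiniteIntegral_iff_ofReal (ae_of_all _ hnn), key]
    exact ENNReal.ofReal_lt_top
  · rw [integral_eq_lintegral_of_nonneg_ae (ae_of_all _ hnn) hmeas.aestronglyMeasurable, key,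
      ENNReal.toReal_ofReal (mul_nonneg hc0 ENNReal.toReal_nonneg)]

namespace Standing

theorem map_Y [IsProbabilityMeasure P] (hM : M.Standing P) (n : ℕ) :
    P.map (M.Y n) = P.map (M.Y 0) := by
  have hs : ∀ n, Measurable fun ω j => M.noise (n + j) ω := fun n =>
    measurable_pi_lambda _ fun j => hM.measurable_noise _
  have h : ∀ n, P.map (M.Y n) = (P.map fun ω j => M.noise j ω).map M.pathY := fun n => by
    rw [← hM.map_shift n, Measure.map_map M.measurable_pathY (hs n)]
    congr 1
    exact funext (M.Y_eq_pathY n)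
  rw [h n, h 0]

/-- Stationarity of the noise, applied to A and Y jointly. Together with `map_Y` it allows the
copies at time n, which are independent of the first n factors, to replace those at time 0. -/
theorem map_A_mul_Y [IsProbabilityMeasure P] (hM : M.Standing P) (n : ℕ) :
    P.map (fun ω => colMul (M.A n ω) (M.Y (n + 1) ω)) =
      P.map fun ω => colMul (M.A 0 ω) (M.Y 1 ω) := by
  have hs : ∀ n, Measurable fun ω j => M.noise (n + j) ω := fun n =>
    measurable_pi_lambda _ fun j => hM.measurable_noise _
  have hf : Measurable fun w : ℕ → (Fin (d + 1) → ℝ) × ℝ =>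
      colMul (M.companion (w 0).1) (M.pathY fun j => w (1 + j)) :=
    measurable_colMul
      (fun i j => (M.measurable_companion i j).comp (measurable_fst.comp (measurable_pi_apply 0)))
      (M.measurable_pathY.comp (measurable_pi_lambda _ fun j => measurable_pi_apply _))
  have h : ∀ n, P.map (fun ω => colMul (M.A n ω) (M.Y (n + 1) ω)) =
      (P.map fun ω j => M.noise j ω).map fun w =>
        colMul (M.companion (w 0).1) (M.pathY fun j => w (1 + j)) := fun n => by
    rw [← hM.map_shift n, Measure.map_map hf (hs n)]
    congr 1
    ext1 ω
    simp only [Y_eq_pathY, Function.comp, A_eq_companion, add_assoc, add_zero]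
  rw [h n, h 0]

end Standing

theorem Gt_eq_smoothTail (hM : M.Standing P) (lam : ℝ) (h : Sph d → ℝ) (x : Sph d) (t : ℝ) :
    M.Gt P lam h x t = smoothTail (P.map (M.Y 0)) lam h (x, t) := by
  have h1 : ∀ u, P.real {ω | u < inner ℝ (x : Vec d) (M.Y 0 ω)} =
      (P.map (M.Y 0)).real {y | u < inner ℝ (x : Vec d) y} := fun u => by
    rw [map_measureReal_apply (hM.measurable_Y 0) (measurableSet_lt_inner _ u)]
    rfl
  simp only [Gt, smoothTail, h1]

/-- By the almost sure recursion, τ₁ + τ₂ is x'Y, so ψ is a difference of two tails, each separately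
integrable against the power weight. -/
theorem g_eq_smoothTail_sub [IsProbabilityMeasure P] (hM : M.Standing P) (hD0 : M.D0 P)
    {lam : ℝ} (hlam : 0 < lam) (h : Sph d → ℝ) (x : Sph d) (t : ℝ) :
    M.g P lam h x t = smoothTail (P.map (M.Y 0)) lam h (x, t) -
      smoothTail (P.map fun ω => colMul (M.A 0 ω) (M.Y 1 ω)) lam h (x, t) := by
  have hm : Measurable fun ω => colMul (M.A 0 ω) (M.Y 1 ω) :=
    (M.measurable_A_mul_Y_future 0).mono (hM.future_le 0) le_rfl
  have : IsProbabilityMeasure (P.map (M.Y 0)) :=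
    Measure.isProbabilityMeasure_map (hM.measurable_Y 0).aemeasurable
  have : IsProbabilityMeasure (P.map fun ω => colMul (M.A 0 ω) (M.Y 1 ω)) :=
    Measure.isProbabilityMeasure_map hm.aemeasurable
  have hs := measurableSet_lt_inner (x : Vec d)
  have h0 : ∀ u, P.real {ω | u < M.τ₁ x ω + M.τ₂ x ω} =
      (P.map (M.Y 0)).real {y | u < inner ℝ (x : Vec d) y} := fun u => by
    rw [map_measureReal_apply (hM.measurable_Y 0) (hs u)]
    refine measureReal_congr ?_
    filter_upwards [hM.ae_Y_eq hD0 0] with ω hω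
    refine propext ?_
    change u < M.τ₁ x ω + M.τ₂ x ω ↔ u < inner ℝ (x : Vec d) (M.Y 0 ω)
    rw [hω, inner_add_right, add_comm]
    rfl
  have h1 : ∀ u, P.real {ω | u < M.τ₁ x ω} =
      (P.map fun ω => colMul (M.A 0 ω) (M.Y 1 ω)).real {y | u < inner ℝ (x : Vec d) y} :=
    fun u => by
      rw [map_measureReal_apply hm (hs u)]
      rfl
  simp only [g, ψ, smoothTail, h0, h1, mul_sub]
  rw [intervalIntegral.integral_sub
    (intervalIntegrable_rpow_mul_measureReal _ hlam.le _ (Real.exp_pos t).le)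
    (intervalIntegrable_rpow_mul_measureReal _ hlam.le _ (Real.exp_pos t).le), mul_sub]

/-- The mean of `G̃(x_n, t - v_n)` under the tilted law, in terms of the original law. -/
def tailMean (M : Model Ω d) (P : Measure Ω) (lam : ℝ) (h : Sph d → ℝ) (x : Sph d) (t : ℝ)
    (n : ℕ) : ℝ :=
  (h x * Real.exp t)⁻¹ * (weightedTail P lam
    (fun ω => inner ℝ (rowMul (x : Vec d) (M.prodA 0 n ω)) (M.Y n ω)) (Real.exp t)).toReal

/-- Markov's inequality bounds the weighted tail by ∫_0^{e^t} u^{lam-1} du times the mean size of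
the remainder A_0⋯A_{n-1}Y_n, which decays geometrically. -/
theorem summable_tailMean [IsProbabilityMeasure P] (hM : M.Standing P) (hD0 : M.D0 P) {lam : ℝ}
    (hlam : 0 < lam) (h : Sph d → ℝ) (x : Sph d) (t : ℝ) :
    Summable (M.tailMean P lam h x t) := by
  obtain ⟨C, r, hC, hr0, hr1, hb⟩ := hM.exists_lintegral_remainder_le hD0
  set K := ∫⁻ u in Set.Ioc 0 (Real.exp t), ENNReal.ofReal (u ^ (lam - 1)) with hK
  have hKtop : K < ∞ := setLIntegral_rpow_sub_one_lt_top hlam (Real.exp_pos t).le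
  have hx : ‖(x : Vec d)‖ = 1 := mem_sphere_zero_iff_norm.1 x.2
  refine Summable.mul_left _ ?_
  refine Summable.of_nonneg_of_le (fun n => ENNReal.toReal_nonneg) (fun n => ?_)
    ((summable_geometric_of_lt_one hr0.le hr1).mul_left (K.toReal * C))
  have hmeas : Measurable fun ω => inner ℝ (rowMul (x : Vec d) (M.prodA 0 n ω)) (M.Y n ω) :=
    (measurable_rowMul (hM.measurable_prodA 0 n) measurable_const).inner (hM.measurable_Y n)
  have h1 : ∫⁻ ω, ‖inner ℝ (rowMul (x : Vec d) (M.prodA 0 n ω)) (M.Y n ω)‖ₑ ∂P ≤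
      ENNReal.ofReal (C * r ^ n) := by
    refine le_trans (lintegral_mono fun ω => ?_) (hb n)
    rw [← inner_colMul, ← ofReal_norm, ← ofReal_norm]
    refine ENNReal.ofReal_le_ofReal ((norm_inner_le_norm _ _).trans ?_)
    rw [hx, one_mul]
  have h2 := (weightedTail_le P lam hmeas (Real.exp t)).trans (mul_le_mul_right h1 K)
  have h3 := ENNReal.toReal_mono (ENNReal.mul_lt_top hKtop ENNReal.ofReal_lt_top).ne h2
  rwa [ENNReal.toReal_mul, ENNReal.toReal_ofReal (by positivity), ← mul_assoc] at h3

theorem IsTiltedLaw.integral_Gt [IsProbabilityMeasure P] (hM : M.Standing P) {lam : ℝ}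
    (hlam : 0 < lam) {h : Sph d → ℝ} (hh : Measurable h) (hpos : ∀ x, 0 < h x) {x : Sph d}
    {μ : Measure (ℕ → Sph d × ℝ)} (hμ : M.IsTiltedLaw P lam h x μ) (n : ℕ) (t : ℝ) :
    Integrable (fun p => M.Gt P lam h (p n).1 (t - (p n).2)) μ ∧
      ∫ p, M.Gt P lam h (p n).1 (t - (p n).2) ∂μ = M.tailMean P lam h x t n := by
  have h1 := hμ.integral_smoothTail hM hlam hh hpos n t (M.measurable_Y_future le_rfl)
  rw [hM.map_Y n] at h1
  simp only [Gt_eq_smoothTail hM]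
  exact h1

/-- `integral_smoothTail` is used twice, with V = Y_n and with V = A_n Y_{n+1}. In the second case
the factor A_n moves into the row product, which advances the index by one. -/
theorem IsTiltedLaw.integral_g [IsProbabilityMeasure P] (hM : M.Standing P) (hD0 : M.D0 P) {lam : ℝ}
    (hlam : 0 < lam) {h : Sph d → ℝ} (hh : Measurable h) (hpos : ∀ x, 0 < h x) {x : Sph d}
    {μ : Measure (ℕ → Sph d × ℝ)} (hμ : M.IsTiltedLaw P lam h x μ) (n : ℕ) (t : ℝ) :
    Integrable (fun p => M.g P lam h (p n).1 (t - (p n).2)) μ ∧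
      ∫ p, M.g P lam h (p n).1 (t - (p n).2) ∂μ =
        M.tailMean P lam h x t n - M.tailMean P lam h x t (n + 1) := by
  have h0 := hμ.integral_smoothTail hM hlam hh hpos n t (M.measurable_Y_future le_rfl)
  have h1 := hμ.integral_smoothTail hM hlam hh hpos n t (M.measurable_A_mul_Y_future n)
  rw [hM.map_Y n] at h0
  rw [hM.map_A_mul_Y n] at h1
  have h2 : ∀ ω, inner ℝ (rowMul (x : Vec d) (M.prodA 0 n ω))
      (colMul (M.A n ω) (M.Y (n + 1) ω)) =
        inner ℝ (rowMul (x : Vec d) (M.prodA 0 (n + 1) ω)) (M.Y (n + 1) ω) := fun ω => by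
    rw [inner_colMul, ← rowMul_mul, prodA, zero_add]
  simp only [h2] at h1
  simp only [g_eq_smoothTail_sub hM hD0 hlam]
  refine ⟨h0.1.sub h1.1, ?_⟩
  rw [integral_sub h0.1 h1.1, h0.2, h1.2]
  rfl

end Model

end RCAR

end

theorem proposition4p4 {Ω : Type*} [MeasurableSpace Ω] (P : Measure Ω) [IsProbabilityMeasure P]
    {d : ℕ} (M : RCAR.Model Ω d) (hM : M.Standing P)
    (hD0 : M.D0 P) (hD1 : M.D1 P) (hD2 : M.D2 P)
    (hq : 0 < M.a (Fin.last d) ^ 2 + M.σ (Fin.last d) ^ 2)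
    -- `lam > 0` solves `κ(lam) = 1`, and `h > 0` is continuous with `Q_lam(h) = κ(lam) h = h`
    (lam : ℝ) (hlam : 0 < lam) (hkappa : M.KappaEq P lam 1)
    (h : RCAR.Sph d → ℝ) (hcont : Continuous h) (hpos : ∀ x, 0 < h x)
    (heig : ∀ x, M.Q P lam h x = h x) :
    -- the series that define `Y` and `Y_1` converge almost surely
    (∀ s, ∀ᵐ ω ∂P, Summable fun k => M.yTerm s k ω) ∧
    ∃ Pt : RCAR.Sph d → Measure (ℕ → RCAR.Sph d × ℝ),
      -- the tilted chain exists
      (∀ x, M.IsTiltedLaw P lam h x (Pt x)) ∧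
      ∀ (x : RCAR.Sph d) (t : ℝ),
        -- the Markov renewal equation
        Integrable (fun p => M.Gt P lam h (p 1).1 (t - (p 1).2)) (Pt x) ∧
        M.Gt P lam h x t =
          (∫ p, M.Gt P lam h (p 1).1 (t - (p 1).2) ∂(Pt x)) + M.g P lam h x t ∧
        -- the series representation
        (∀ n, Integrable (fun p => M.g P lam h (p n).1 (t - (p n).2)) (Pt x)) ∧
        HasSum (fun n => ∫ p, M.g P lam h (p n).1 (t - (p n).2) ∂(Pt x)) (M.Gt P lam h x t) := by
  have hh : Measurable h := hcont.measurable
  choose Pt hPt using RCAR.Model.exists_isTiltedLaw hM hlam hh hpos heig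
  refine ⟨hM.ae_summable_yTerm hD0, Pt, hPt, fun x t => ?_⟩
  have hG := fun n => (hPt x).integral_Gt hM hlam hh hpos n t
  have hg := fun n => (hPt x).integral_g hM hD0 hlam hh hpos n t
  have hm : Measurable fun ω => RCAR.colMul (M.A 0 ω) (M.Y 1 ω) :=
    (M.measurable_A_mul_Y_future 0).mono (hM.future_le 0) le_rfl
  have hY0 : ∀ u, P.real {ω | u < inner ℝ (x : RCAR.Vec d) (M.Y 0 ω)} = P.real {ω | u <
      inner ℝ (RCAR.rowMul (x : RCAR.Vec d) (M.prodA 0 0 ω)) (M.Y 0 ω)} := fun u => by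
    simp only [RCAR.Model.prodA, RCAR.rowMul_one]
  have hG0 : M.Gt P lam h x t = M.tailMean P lam h x t 0 := by
    simp only [RCAR.Model.Gt, hY0]
    rw [RCAR.integral_rpow_mul_measureReal P lam _ (Real.exp_pos t).le]
    rfl
  have hg0 : M.g P lam h x t = M.tailMean P lam h x t 0 - M.tailMean P lam h x t 1 := by
    have h1 : ∀ ω, M.τ₁ x ω =
        inner ℝ (RCAR.rowMul (x : RCAR.Vec d) (M.prodA 0 1 ω)) (M.Y 1 ω) := fun ω => by
      rw [RCAR.Model.τ₁, RCAR.inner_colMul]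
      simp [RCAR.Model.prodA]
    rw [RCAR.Model.g_eq_smoothTail_sub hM hD0 hlam, ← RCAR.Model.Gt_eq_smoothTail hM, hG0]
    congr 1
    have h2 : ∀ u, (P.map fun ω => RCAR.colMul (M.A 0 ω) (M.Y 1 ω)).real
        {y | u < inner ℝ (x : RCAR.Vec d) y} = P.real {ω | u < inner ℝ
          (RCAR.rowMul (x : RCAR.Vec d) (M.prodA 0 1 ω)) (M.Y 1 ω)} := fun u => by
      rw [map_measureReal_apply hm (RCAR.measurableSet_lt_inner _ u)]
      simp only [← h1]
      rfl
    simp only [RCAR.smoothTail, h2]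
    rw [RCAR.integral_rpow_mul_measureReal P lam _ (Real.exp_pos t).le]
    rfl
  refine ⟨(hG 1).1, ?_, fun n => (hg n).1, ?_⟩
  · rw [(hG 1).2, hG0, hg0, add_sub_cancel]
  · simp only [fun n => (hg n).2]
    rw [hG0]
    -- Summability of T_n, more than T_n → 0, gives unconditional and hence absolute convergence:
    -- the sum is ∑ T_n - ∑ T_{n+1} = T_0.
    have hs := RCAR.Model.summable_tailMean hM hD0 hlam h x t
    have h1 := hs.hasSum.sub ((summable_nat_add_iff 1).2 hs).hasSum
    rwa [hs.tsum_eq_zero_add, add_sub_cancel_right] at h1
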